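/- Let $(\Omega,\nu)$ be an atomless standard Borel probability space (equivalently, a copy of $[0,1]$ with Lebesgue measure). Let $\mathcal W_0$ be the space of graphons, i.e. symmetric measurable functions $W:\Omega^2\to[0,1]$ modulo equality $\nu^{\otimes 2}$-almost everywhere. For a measure preserving bijection $\varphi$ of $\Omega$ let $W^\varphi(x,y)=W(\varphi(x),\varphi(y))$ (a version of $W$), and put $$\delta_\square(U,W)=\inf_\varphi\ \sup_{S,T\subseteq\Omega\text{ measurable}}\Big|\int_{S\times T}(U-W^\varphi)\,d\nu^{\otimes 2}\Big| ,$$ where $\varphi$ ranges over all measure preserving bijections of $\Omega$. Let $\widetilde{\mathcal W}_0$ be the quotient of $\mathcal W_0$ by weak isomorphism, $\delta_\square(U,W)=0$, with the metric induced by $\delta_\square$; write $[\![W]\!]$ for the class of $W$. Equip $\mathcal W_0$ with the weak* topology inherited from $L^\infty(\Omega^2)=L^1(\Omega^2)^*$; this makes $\mathcal W_0$ a compact metrizable space. Let $K(\mathcal W_0)$ be the space of compact subsets of $\mathcal W_0$ with the Vietoris topology. The envelope $\langle W\rangle$ of a graphon $W$ is the set of all weak* limits of sequences $W^{\varphi_1},W^{\varphi_2},\dots$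 of versions of $W$. Then each $\langle W\rangle$ is compact and depends only on $[\![W]\!]$, and the envelope map $\langle\cdot\rangle:(\widetilde{\mathcal W}_0,\delta_\square)\to K(\mathcal W_0)$ is a continuous injection. Its image is closed in $K(\mathcal W_0)$ and it is a homeomorphism onto its image. Moreover, for every metric $d_{\mathrm w^*}$ on $\mathcal W_0$ compatible with the weak* topology, the pullback $\chi$ to $\widetilde{\mathcal W}_0$, along the envelope map, of the Hausdorff metric derived from $d_{\mathrm w^*}$ is a metric, it is given by $$\chi([\![U]\!],[\![W]\!])=\max\Big\{\sup_\varphi\inf_\psi d_{\mathrm w^*}(U^\varphi,W^\psi),\ \sup_\varphi\inf_\psi d_{\mathrm w^*}(U^\psi,W^\varphi)\Big\}$$ with $\varphi,\psi$ ranging over all measure preserving bijections of $\Omega$, and it is equivalent to $\delta_\square$, i.e. it induces the same topology on $\widetilde{\mathcal W}_0$. Finally, $(\widetilde{\mathcal W}_0,\delta_\square)$ is compact. -/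

import Mathlib

open MeasureTheory Filter Topology

noncomputable section

namespace GraphonSpace

variable {Ω : Type*} [MeasurableSpace Ω]

/-- The space of graphons: symmetric measurable functions from the square of `Ω` to `[0,1]`,
modulo equality almost everywhere with respect to the product measure. -/
@[ext]
structure Graphon (μ : Measure Ω) where
  toAEEqFun : (Ω × Ω) →ₘ[μ.prod μ] ℝ
  exists_rep : ∃ w : Ω × Ω → ℝ, Measurable w ∧ (∀ p, w p ∈ Set.Icc (0 : ℝ) 1) ∧
    (∀ x y, w (x, y) = w (y, x)) ∧ toAEEqFun =ᵐ[μ.prod μ] w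

instance (μ : Measure Ω) : CoeFun (Graphon μ) (fun _ => Ω × Ω → ℝ) :=
  ⟨fun W => (W.toAEEqFun : Ω × Ω → ℝ)⟩

/-- The weak* topology on graphons, viewed as elements of the dual of `L¹`: the coarsest
topology for which `W ↦ ∫ f * W` is continuous for every `f` in `L¹`. -/
instance weakStarTopology (μ : Measure Ω) : TopologicalSpace (Graphon μ) :=
  TopologicalSpace.induced
    (fun (W : Graphon μ) (f : Lp ℝ 1 (μ.prod μ)) => ∫ p, f p * W p ∂(μ.prod μ))
    Pi.topologicalSpace

/-- Measure preserving bijections of `Ω`. On a standard Borel space the measurability of the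
inverse is automatic. -/
@[ext]
structure MPBij (μ : Measure Ω) where
  toEquiv : Ω ≃ᵐ Ω
  measurePreserving : MeasurePreserving toEquiv μ μ

/-- The identity as a measure preserving bijection. -/
def MPBij.refl (μ : Measure Ω) : MPBij μ := ⟨MeasurableEquiv.refl Ω, MeasurePreserving.id μ⟩

/-- The inverse of a measure preserving bijection. -/
def MPBij.symm {μ : Measure Ω} (φ : MPBij μ) : MPBij μ :=
  ⟨φ.1.symm, MeasurePreserving.symm φ.1 φ.2⟩

/-- `φ.trans ψ` is the composition `x ↦ ψ (φ x)`. -/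
def MPBij.trans {μ : Measure Ω} (φ ψ : MPBij μ) : MPBij μ :=
  ⟨φ.1.trans ψ.1, ψ.2.comp φ.2⟩

instance (μ : Measure Ω) : Nonempty (MPBij μ) := ⟨MPBij.refl μ⟩

theorem MPBij.prodMap {μ : Measure Ω} [SFinite μ] (φ : MPBij μ) :
    MeasurePreserving (Prod.map φ.toEquiv φ.toEquiv) (μ.prod μ) (μ.prod μ) :=
  φ.2.prod φ.2

variable {μ : Measure Ω}

/-- The version of `W` under `φ`, namely `(x, y) ↦ W (φ x, φ y)`. -/
def version [SFinite μ] (W : Graphon μ) (φ : MPBij μ) : Graphon μ :=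
  ⟨W.toAEEqFun.compMeasurePreserving (Prod.map φ.toEquiv φ.toEquiv) φ.prodMap, by
    obtain ⟨w, hw, h01, hs, hW⟩ := W.2
    refine ⟨w ∘ Prod.map φ.1 φ.1, hw.comp φ.prodMap.measurable, fun p => h01 _,
      fun x y => hs _ _, ?_⟩
    exact (AEEqFun.coeFn_compMeasurePreserving _ _).trans
      (φ.prodMap.quasiMeasurePreserving.ae_eq_comp hW)⟩

/-- The cut norm: the supremum of `|∫_{S × T} Y|` over measurable sets `S, T`. -/
def cutNorm (μ : Measure Ω) (Y : Ω × Ω → ℝ) : ℝ :=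
  ⨆ R : {S : Set Ω // MeasurableSet S} × {T : Set Ω // MeasurableSet T},
    |∫ p in R.1.1 ×ˢ R.2.1, Y p ∂(μ.prod μ)|

/-- The cut norm distance `d_□`. -/
def cutNormDist (U W : Graphon μ) : ℝ := cutNorm μ (fun p => U p - W p)

/-- The cut distance `δ_□`. -/
def cutDist [SFinite μ] (U W : Graphon μ) : ℝ := ⨅ φ : MPBij μ, cutNormDist U (version W φ)

/-- The envelope of `W`: all weak* limits of sequences of versions of `W`. -/
def envelope [SFinite μ] (W : Graphon μ) : Set (Graphon μ) :=
  {U | ∃ φ : ℕ → MPBij μ, Tendsto (fun n => version W (φ n)) atTop (𝓝 U)}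

/-! The cut distance is a pseudometric. -/

theorem Graphon.integrable [IsFiniteMeasure μ] (W : Graphon μ) : Integrable W (μ.prod μ) := by
  obtain ⟨w, hw, h01, -, hW⟩ := W.2
  refine (Integrable.of_bound hw.aestronglyMeasurable 1 (ae_of_all _ fun p => ?_)).congr hW.symm
  rw [Real.norm_eq_abs, abs_le]
  exact ⟨by linarith [(h01 p).1], (h01 p).2⟩

theorem le_cutNorm {Y : Ω × Ω → ℝ} (hY : Integrable Y (μ.prod μ)) {S T : Set Ω}
    (hS : MeasurableSet S) (hT : MeasurableSet T) :
    |∫ p in S ×ˢ T, Y p ∂(μ.prod μ)| ≤ cutNorm μ Y := by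
  refine le_ciSup (f := fun R : {S : Set Ω // MeasurableSet S} × {T : Set Ω // MeasurableSet T} =>
    |∫ p in R.1.1 ×ˢ R.2.1, Y p ∂(μ.prod μ)|) ⟨∫ p, |Y p| ∂(μ.prod μ), ?_⟩ (⟨S, hS⟩, ⟨T, hT⟩)
  rintro _ ⟨R, rfl⟩
  exact (abs_integral_le_integral_abs).trans
    (setIntegral_le_integral hY.abs (ae_of_all _ fun p => abs_nonneg _))

theorem cutNorm_le {Y : Ω × Ω → ℝ} {c : ℝ}
    (h : ∀ S T : Set Ω, MeasurableSet S → MeasurableSet T →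
      |∫ p in S ×ˢ T, Y p ∂(μ.prod μ)| ≤ c) : cutNorm μ Y ≤ c := by
  have : Nonempty ({S : Set Ω // MeasurableSet S} × {T : Set Ω // MeasurableSet T}) :=
    ⟨(⟨∅, .empty⟩, ⟨∅, .empty⟩)⟩
  exact ciSup_le fun R => h _ _ R.1.2 R.2.2

theorem cutNormDist_nonneg (U W : Graphon μ) : 0 ≤ cutNormDist U W :=
  Real.iSup_nonneg fun _ => abs_nonneg _

theorem cutNormDist_self (U : Graphon μ) : cutNormDist U U = 0 :=
  le_antisymm (cutNorm_le fun S T _ _ => by simp) (cutNormDist_nonneg U U)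

theorem cutNormDist_comm (U W : Graphon μ) : cutNormDist U W = cutNormDist W U := by
  unfold cutNormDist cutNorm
  congr 1
  ext R
  rw [← abs_neg, ← integral_neg]
  simp

theorem cutNormDist_triangle [IsFiniteMeasure μ] (U V W : Graphon μ) :
    cutNormDist U W ≤ cutNormDist U V + cutNormDist V W := by
  refine cutNorm_le fun S T hS hT => ?_
  have h1 := U.integrable.sub V.integrable
  have h2 := V.integrable.sub W.integrable
  have e : ∫ p in S ×ˢ T, (U p - W p) ∂(μ.prod μ)
      = (∫ p in S ×ˢ T, (U p - V p) ∂(μ.prod μ)) + ∫ p in S ×ˢ T, (V p - W p) ∂(μ.prod μ) := by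
    refine (integral_congr_ae (ae_of_all _ fun p => ?_)).trans
      (integral_add h1.integrableOn h2.integrableOn)
    simp
  rw [e]
  exact (abs_add_le _ _).trans (add_le_add (le_cutNorm h1 hS hT) (le_cutNorm h2 hS hT))

theorem version_coe [SFinite μ] (W : Graphon μ) (φ : MPBij μ) :
    (version W φ : Ω × Ω → ℝ) =ᵐ[μ.prod μ] fun p => W (φ.toEquiv p.1, φ.toEquiv p.2) :=
  AEEqFun.coeFn_compMeasurePreserving _ φ.prodMap

theorem version_refl [SFinite μ] (W : Graphon μ) : version W (MPBij.refl μ) = W :=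
  Graphon.ext (AEEqFun.ext (version_coe W _))

theorem version_version [SFinite μ] (W : Graphon μ) (φ ψ : MPBij μ) :
    version (version W ψ) φ = version W (φ.trans ψ) := by
  refine Graphon.ext (AEEqFun.ext ((version_coe _ φ).trans ?_))
  refine EventuallyEq.trans ?_ (version_coe W _).symm
  exact φ.prodMap.quasiMeasurePreserving.ae_eq_comp (version_coe W ψ)

theorem version_symm [SFinite μ] (W : Graphon μ) (φ : MPBij μ) :
    version (version W φ) φ.symm = W := by
  rw [version_version]
  have : φ.symm.trans φ = MPBij.refl μ := 
    MPBij.ext (by ext x; simp [MPBij.trans, MPBij.symm, MPBij.refl])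
  rw [this, version_refl]

theorem cutNormDist_version_le [IsFiniteMeasure μ] (U W : Graphon μ) (φ : MPBij μ) :
    cutNormDist (version U φ) (version W φ) ≤ cutNormDist U W := by
  refine cutNorm_le fun S T hS hT => ?_
  have h := U.integrable.sub W.integrable
  have hpre : S ×ˢ T = Prod.map φ.1 φ.1 ⁻¹' ((φ.1.symm ⁻¹' S) ×ˢ (φ.1.symm ⁻¹' T)) := by
    ext p
    simp
  have e : ∫ p in S ×ˢ T, (version U φ p - version W φ p) ∂(μ.prod μ)
      = ∫ p in (φ.1.symm ⁻¹' S) ×ˢ (φ.1.symm ⁻¹' T), (U p - W p) ∂(μ.prod μ) := by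
    rw [← φ.prodMap.setIntegral_preimage_emb
      (φ.1.prodCongr φ.1).measurableEmbedding (fun p => U p - W p), ← hpre]
    refine integral_congr_ae (ae_restrict_of_ae ?_)
    filter_upwards [version_coe U φ, version_coe W φ] with p h1 h2
    rw [h1, h2]
    rfl
  rw [e]
  exact le_cutNorm h (φ.1.symm.measurable hS) (φ.1.symm.measurable hT)

theorem bddBelow_cutDist [SFinite μ] (U W : Graphon μ) :
    BddBelow (Set.range fun φ : MPBij μ => cutNormDist U (version W φ)) :=
  ⟨0, by rintro _ ⟨φ, rfl⟩; exact cutNormDist_nonneg _ _⟩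

theorem cutDist_nonneg [SFinite μ] (U W : Graphon μ) : 0 ≤ cutDist U W :=
  le_ciInf fun _ => cutNormDist_nonneg _ _

theorem cutDist_self [SFinite μ] (U : Graphon μ) : cutDist U U = 0 := by
  refine le_antisymm ((ciInf_le (bddBelow_cutDist U U) (MPBij.refl μ)).trans ?_)
    (cutDist_nonneg U U)
  rw [version_refl, cutNormDist_self]

theorem cutDist_comm [IsFiniteMeasure μ] (U W : Graphon μ) : cutDist U W = cutDist W U := by
  have key : ∀ U W : Graphon μ, cutDist U W ≤ cutDist W U := fun U W => le_ciInf fun φ => by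
    refine (ciInf_le (bddBelow_cutDist U W) φ.symm).trans ?_
    have := cutNormDist_version_le (version U φ) W φ.symm
    rw [version_symm] at this
    exact this.trans_eq (cutNormDist_comm _ _)
  exact le_antisymm (key U W) (key W U)

theorem cutDist_triangle [IsFiniteMeasure μ] (U V W : Graphon μ) :
    cutDist U W ≤ cutDist U V + cutDist V W :=
  le_ciInf_add_ciInf fun φ ψ => by
    refine (ciInf_le (bddBelow_cutDist U W) (φ.trans ψ)).trans ?_
    rw [← version_version]
    exact (cutNormDist_triangle _ (version V φ) _).trans
      (add_le_add le_rfl (cutNormDist_version_le _ _ φ))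

/-- Weak isomorphism of graphons: `δ_□ (U, W) = 0`. -/
def weakIso (μ : Measure Ω) [IsFiniteMeasure μ] : Setoid (Graphon μ) where
  r U W := cutDist U W = 0
  iseqv :=
    ⟨cutDist_self, fun {U W} h => by rw [cutDist_comm, h], fun {U V W} h1 h2 =>
      le_antisymm ((cutDist_triangle U V W).trans (by rw [h1, h2, add_zero]))
        (cutDist_nonneg U W)⟩

/-- Graphons modulo weak isomorphism. -/
def UnlabelledGraphon (μ : Measure Ω) [IsFiniteMeasure μ] : Type _ := Quotient (weakIso μ)

/-- The weak isomorphism class of a graphon. -/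
def UnlabelledGraphon.mk [IsFiniteMeasure μ] (W : Graphon μ) : UnlabelledGraphon μ :=
  Quotient.mk (weakIso μ) W

/-- The metric on weak isomorphism classes of graphons that is given by `δ_□`. -/
instance cutMetric (μ : Measure Ω) [IsFiniteMeasure μ] : MetricSpace (UnlabelledGraphon μ) where
  dist := Quotient.lift₂ cutDist fun U W U' W' (hU : cutDist U U' = 0) (hW : cutDist W W' = 0) => by
    have hU' := (cutDist_comm U' U).trans hU
    have hW' := (cutDist_comm W' W).trans hW
    have h1 := cutDist_triangle U U' W
    have h2 := cutDist_triangle U' W' W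
    have h3 := cutDist_triangle U' U W'
    have h4 := cutDist_triangle U W W'
    linarith
  dist_self := by rintro ⟨U⟩; exact cutDist_self U
  dist_comm := by rintro ⟨U⟩ ⟨W⟩; exact cutDist_comm U W
  dist_triangle := by rintro ⟨U⟩ ⟨V⟩ ⟨W⟩; exact cutDist_triangle U V W
  eq_of_dist_eq_zero := by rintro ⟨U⟩ ⟨W⟩ h; exact Quotient.sound h

theorem dist_mk [IsFiniteMeasure μ] (U W : Graphon μ) :
    dist (UnlabelledGraphon.mk U) (UnlabelledGraphon.mk W) = cutDist U W := rfl

/-- The Hausdorff distance of two sets of graphons with respect to a metric `ρ` on graphons. -/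
def hausdorffDistOf (ρ : MetricSpace (Graphon μ)) (K L : Set (Graphon μ)) : ℝ :=
  @Metric.hausdorffDist (Graphon μ) ρ.toPseudoMetricSpace K L

end GraphonSpace

end

noncomputable section

namespace GraphonSpace

/-! ### Rearranging an atomless standard Borel probability space -/

section Rearrangement

variable {Ω : Type*} [MeasurableSpace Ω]

/-! Everything reduces to two facts: the space of classes is compact for the cut distance, and the
envelope map is a continuous injection. A continuous injection of a compact space into a Hausdorff
space is a closed embedding. This gives the closed image and the homeomorphism, and shows that any
Hausdorff metric pulled back along the map induces the original topology. The formula for that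
metric holds because an envelope is the weak* closure of the set of versions and Hausdorff distance
does not see closures.

Continuity: if `cutDist U W < δ`, every version of `U` is within `δ` in cut norm of a version of
`W`, and conversely. By weak* compactness, cut norm closeness implies closeness in a compatible
metric, uniformly over all pairs (`exists_forall_cutNormDist_lt_imp_dist_lt`).

Injectivity: the `L²` norm is invariant under versions and can only drop in a weak* limit. If `U`
and `W` have the same envelope, each lies in the envelope of the other, so their norms agree. Then
versions of `W` converging weakly to `U` converge in `L²`, hence in cut norm
(`cutDist_eq_zero_of_envelope_eq`).

Compactness is completeness plus total boundedness. For completeness, a fast Cauchy sequence is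
aligned by versions until it is Cauchy in cut norm; a weak* cluster point is its limit, since the
cut norm is weak* lower semicontinuous. For total boundedness, weak regularity
(`exists_stepKernel_approx`) approximates all graphons by combinations of a fixed number `K` of
rectangles. Up to a measure preserving bijection such a combination is determined approximately by
its coefficients and by the distribution of the labels recording which sides contain a point
(`cutDist_le_of_stepKernel`). These are boundedly many bounded parameters. Matching labels is where
the space must be atomless and standard Borel (`exists_mpBij_label_ne_le`). -/

theorem exists_uncountable_null_set [StandardBorelSpace Ω] (μ : Measure Ω)
    [IsProbabilityMeasure μ] [NullSingletonClass μ] :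
    ∃ Z : Set Ω, MeasurableSet Z ∧ μ Z = 0 ∧ ¬ Z.Countable := by
  have hΩ : ¬ Countable Ω := fun h => by
    have := (Set.countable_univ (α := Ω)).measure_zero μ
    simp at this
  have hR : ¬ Countable (ℝ × ℝ) := fun h => by
    have : Countable ℝ := Function.Injective.countable (f := fun x : ℝ => (x, (0 : ℝ)))
      fun x y h => (Prod.ext_iff.1 h).1
    exact Cardinal.not_countable_real (Set.countable_univ)
  let e : Ω ≃ᵐ ℝ × ℝ := PolishSpace.measurableEquivOfNotCountable hΩ hR
  let A : ℝ → Set Ω := fun x => e ⁻¹' (Prod.fst ⁻¹' {x})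
  have hA : ∀ x, MeasurableSet (A x) := fun x =>
    e.measurable (measurable_fst (measurableSet_singleton x))
  -- The fibres over distinct reals are disjoint, so all but countably many of them are null, while
  -- each is uncountable.
  have hd : Pairwise (Function.onFun Disjoint A) := fun x y hxy =>
    Set.disjoint_left.2 fun ω hx hy => hxy (by
      simp only [A, Set.mem_preimage, Set.mem_singleton_iff] at hx hy
      rw [← hx, ← hy])
  have hc := Measure.countable_meas_pos_of_disjoint_iUnion (μ := μ) hA hd
  obtain ⟨x, hx⟩ : ∃ x, x ∉ {i | 0 < μ (A i)} := by
    by_contra! h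
    exact Cardinal.not_countable_real (hc.mono fun x _ => h x)
  refine ⟨A x, hA x, by simpa using hx, fun h => ?_⟩
  have : (Set.univ : Set ℝ).Countable := by
    refine (h.image (fun ω => (e ω).2)).mono fun y _ => ?_
    exact ⟨e.symm (x, y), by simp [A], by simp⟩
  exact Cardinal.not_countable_real this

/-- Two measurable functions with the same law which are both injective off a null set differ by
a measure preserving bijection. -/
theorem exists_mpBij_comp_ae_eq [StandardBorelSpace Ω] {μ : Measure Ω}
    [IsProbabilityMeasure μ] [NullSingletonClass μ] {T₁ T₂ : Ω → ℝ} (h₁ : Measurable T₁)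
    (h₂ : Measurable T₂) (hlaw : μ.map T₁ = μ.map T₂) {N₁ N₂ : Set Ω}
    (hN₁ : MeasurableSet N₁) (hN₂ : MeasurableSet N₂) (hμ₁ : μ N₁ = 0) (hμ₂ : μ N₂ = 0)
    (hi₁ : Set.InjOn T₁ N₁ᶜ) (hi₂ : Set.InjOn T₂ N₂ᶜ) :
    ∃ φ : MPBij μ, ∀ᵐ x ∂μ, T₂ (φ.toEquiv x) = T₁ x := by
  classical
  -- Discarding `Z` on both sides leaves uncountable leftover sets, which are Borel isomorphic. This
  -- extends an almost everywhere defined bijection to all of `Ω`.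
  obtain ⟨Z, hZ, hZ0, hZc⟩ := exists_uncountable_null_set μ
  have key : ∀ {T : Ω → ℝ} {N : Set Ω}, Measurable T → MeasurableSet N → μ N = 0 →
      Set.InjOn T Nᶜ → MeasurableSet (T '' (N ∪ Z)ᶜ) ∧ ∀ᵐ y ∂(μ.map T), y ∈ T '' (N ∪ Z)ᶜ := by
    intro T N hT hN hN0 hi
    -- Injective Borel images of Borel sets are Borel (Lusin–Souslin).
    have hm : MeasurableSet (T '' (N ∪ Z)ᶜ) :=
      (hN.union hZ).compl.image_of_measurable_injOn hT
        (hi.mono (Set.compl_subset_compl.2 Set.subset_union_left))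
    refine ⟨hm, (ae_map_iff hT.aemeasurable hm).2 ?_⟩
    have : ∀ᵐ x ∂μ, x ∉ N ∪ Z :=
      measure_eq_zero_iff_ae_notMem.1 (measure_union_null hN0 hZ0)
    filter_upwards [this] with x hx using ⟨x, hx, rfl⟩
  obtain ⟨m₁, a₁⟩ := key h₁ hN₁ hμ₁ hi₁
  obtain ⟨m₂, a₂⟩ := key h₂ hN₂ hμ₂ hi₂
  set G := T₁ '' (N₁ ∪ Z)ᶜ ∩ T₂ '' (N₂ ∪ Z)ᶜ with hG
  have mG : MeasurableSet G := m₁.inter m₂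
  have aG : ∀ᵐ y ∂(μ.map T₁), y ∈ G := by
    rw [← hlaw] at a₂
    filter_upwards [a₁, a₂] with y h h' using ⟨h, h'⟩
  have part : ∀ {T : Ω → ℝ} {N : Set Ω}, Measurable T → MeasurableSet N → μ N = 0 →
      Set.InjOn T Nᶜ → G ⊆ T '' (N ∪ Z)ᶜ → (∀ᵐ y ∂(μ.map T), y ∈ G) →
      ∃ Y : Set Ω, MeasurableSet Y ∧ (∀ᵐ x ∂μ, x ∈ Y) ∧ ¬ Countable (Yᶜ : Set Ω) ∧
        Set.InjOn T Y ∧ ∃ e : Y ≃ᵐ G, ∀ x, (e x : ℝ) = T x := by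
    intro T N hT hN hN0 hi hsub hae
    let Y := (N ∪ Z)ᶜ ∩ T ⁻¹' G
    have mY : MeasurableSet Y := (hN.union hZ).compl.inter (hT mG)
    have hiY : Set.InjOn T Y := hi.mono fun x hx h => hx.1 (Or.inl h)
    refine ⟨Y, mY, ?_, fun h => hZc ?_, hiY, ?_⟩
    · filter_upwards [measure_eq_zero_iff_ae_notMem.1 (measure_union_null hN0 hZ0),
        ae_of_ae_map hT.aemeasurable hae] with x h h' using ⟨h, h'⟩
    · exact (Set.countable_coe_iff.1 h).mono fun x hx (hY : x ∈ Y) => hY.1 (Or.inr hx)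
    · have := mY.standardBorel
      have hemb : MeasurableEmbedding (fun x : Y => T x) :=
        (hT.comp measurable_subtype_coe).measurableEmbedding
          fun x y h => Subtype.ext (hiY x.2 y.2 h)
      have hr : Set.range (fun x : Y => T x) = G := by
        ext y
        constructor
        · rintro ⟨x, rfl⟩
          exact x.2.2
        · intro hy
          obtain ⟨x, hx, rfl⟩ := hsub hy
          exact ⟨⟨x, hx, hy⟩, rfl⟩
      exact ⟨hemb.equivRange.trans (MeasurableEquiv.cast (by rw [hr]) (by rw [hr])), by
        intro x
        have : ∀ {s t : Set ℝ} (h : s = t) (h' : (s : Type) = t) (h'' ) (y : s),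
            ((MeasurableEquiv.cast h' h'' y : t) : ℝ) = y := by
          rintro s _ rfl _ _ y; rfl
        exact (this hr (by rw [hr]) (by rw [hr]) (hemb.equivRange x)).trans
          (by rw [hemb.equivRange_apply])⟩
  obtain ⟨Y₁, mY₁, aY₁, cY₁, iY₁, e₁, he₁⟩ :=
    part h₁ hN₁ hμ₁ hi₁ Set.inter_subset_left aG
  obtain ⟨Y₂, mY₂, aY₂, cY₂, iY₂, e₂, he₂⟩ :=
    part h₂ hN₂ hμ₂ hi₂ Set.inter_subset_right (by rwa [← hlaw])
  have := mY₁.compl.standardBorel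
  have := mY₂.compl.standardBorel
  -- On `Y₁` this is `T₂⁻¹ ∘ T₁` through the common image `G`; on the null complements it is an
  -- arbitrary Borel isomorphism.
  let φ : Ω ≃ᵐ Ω := (MeasurableEquiv.sumCompl mY₁).symm.trans
    (((e₁.trans e₂.symm).sumCongr (PolishSpace.measurableEquivOfNotCountable cY₁ cY₂)).trans
      (MeasurableEquiv.sumCompl mY₂))
  have hφ : ∀ x (hx : x ∈ Y₁), φ x = e₂.symm (e₁ ⟨x, hx⟩) := by
    intro x hx
    have : (MeasurableEquiv.sumCompl mY₁).symm x = Sum.inl ⟨x, hx⟩ := by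
      rw [MeasurableEquiv.symm_apply_eq]; rfl
    simp only [φ, MeasurableEquiv.trans_apply, this]
    rfl
  have hφY : ∀ x ∈ Y₁, φ x ∈ Y₂ := fun x hx => by rw [hφ x hx]; exact Subtype.coe_prop _
  have hφT : ∀ x ∈ Y₁, T₂ (φ x) = T₁ x := fun x hx => by
    rw [hφ x hx, ← he₂, MeasurableEquiv.apply_symm_apply, he₁]
  refine ⟨⟨φ, φ.measurable, ?_⟩, aY₁.mono hφT⟩
  ext A hA
  rw [φ.map_apply]
  have mI : MeasurableSet (T₂ '' (A ∩ Y₂)) :=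
    (hA.inter mY₂).image_of_measurable_injOn h₂ (iY₂.mono Set.inter_subset_right)
  calc μ (φ ⁻¹' A) = μ (T₁ ⁻¹' (T₂ '' (A ∩ Y₂))) := by
        refine measure_congr (aY₁.mono fun x hx => propext ?_)
        constructor
        · intro h
          exact ⟨φ x, ⟨h, hφY x hx⟩, hφT x hx⟩
        · rintro ⟨y, hy, hyx⟩
          have : y = φ x := iY₂ hy.2 (hφY x hx) (hyx.trans (hφT x hx).symm)
          exact (congrArg (· ∈ A) this).mp hy.1
    _ = μ (T₂ ⁻¹' (T₂ '' (A ∩ Y₂))) := by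
        rw [← Measure.map_apply h₁ mI, hlaw, Measure.map_apply h₂ mI]
    _ = μ A := by
        refine measure_congr (aY₂.mono fun x hx => propext ?_)
        constructor
        · rintro ⟨y, hy, hyx⟩
          exact iY₂ hy.2 hx hyx ▸ hy.1
        · intro h
          exact ⟨x, ⟨h, hx⟩, rfl⟩

/-- The distribution function of an atomless law pushes it to the uniform law. -/
theorem map_distribution_eq_uniform (m : Measure ℝ) [IsProbabilityMeasure m]
    [NullSingletonClass m] :
    Measurable (fun x => m.real (Set.Iic x)) ∧
      m.map (fun x => m.real (Set.Iic x)) = volume.restrict (Set.Icc (0 : ℝ) 1) := by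
  set F : ℝ → ℝ := fun x => m.real (Set.Iic x) with hF
  have hFc : F = ProbabilityTheory.cdf m := by
    ext x; rw [ProbabilityTheory.cdf_eq_real]
  have mono : Monotone F := hFc ▸ ProbabilityTheory.monotone_cdf m
  have meas : Measurable F := mono.measurable
  -- Left continuity is exactly the absence of atoms.
  have cont : Continuous F := by
    rw [continuous_iff_continuousAt]
    intro a
    rw [continuousAt_iff_continuous_left'_right']
    constructor
    · have h1 := StieltjesFunction.measure_singleton (ProbabilityTheory.cdf m) a
      rw [ProbabilityTheory.measure_cdf, measure_singleton] at h1
      have h2 := ENNReal.ofReal_eq_zero.1 h1.symm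
      have h3 := (ProbabilityTheory.monotone_cdf m).leftLim_le (le_refl a)
      have h4 : Function.leftLim (ProbabilityTheory.cdf m) a = ProbabilityTheory.cdf m a := by
        linarith
      rw [hFc]
      exact (ProbabilityTheory.monotone_cdf m).continuousWithinAt_Iio_iff_leftLim_eq.2 h4
    · rw [hFc]
      exact ((ProbabilityTheory.cdf m).right_continuous a).mono Set.Ioi_subset_Ici_self
  have h0 : Tendsto F atBot (𝓝 0) := hFc ▸ ProbabilityTheory.tendsto_cdf_atBot m
  have h1 : Tendsto F atTop (𝓝 1) := hFc ▸ ProbabilityTheory.tendsto_cdf_atTop m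
  have surj : ∀ t ∈ Set.Ioo (0 : ℝ) 1, ∃ x, F x = t := fun t ht => by
    obtain ⟨a, ha⟩ := (h0.eventually (gt_mem_nhds ht.1)).exists
    obtain ⟨b, hb⟩ := (h1.eventually (lt_mem_nhds ht.2)).exists
    exact mem_range_of_exists_le_of_exists_ge cont ⟨a, ha.le⟩ ⟨b, hb.le⟩
  refine ⟨meas, ?_⟩
  have hF0 : ∀ x, 0 ≤ F x := fun x => measureReal_nonneg
  have hF1 : ∀ x, F x ≤ 1 := fun x => measureReal_le_one
  have := Measure.isProbabilityMeasure_map (μ := m) meas.aemeasurable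
  -- The gap `t < t'` avoids discussing intervals on which `F` is constant; it is closed afterwards
  -- by letting `t'` decrease to `t`.
  have upper : ∀ t t', 0 < t' → t' < 1 → t < t' → m.real (F ⁻¹' Set.Iic t) ≤ t' := by
    intro t t' h h' htt
    obtain ⟨x, hx⟩ := surj t' ⟨h, h'⟩
    rw [← hx]
    refine measureReal_mono fun y hy => ?_
    by_contra hxy
    have h3 := mono (not_le.1 hxy).le
    have h4 : F y ≤ t := hy
    linarith
  have main : ∀ t, m.real (F ⁻¹' Set.Iic t) = max 0 (min t 1) := by
    intro t
    rcases lt_or_ge t 0 with ht | ht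
    · have : F ⁻¹' Set.Iic t = ∅ := Set.eq_empty_of_forall_notMem fun x hx =>
        absurd (hF0 x) (not_le.2 (lt_of_le_of_lt hx ht))
      rw [this, min_eq_left (by linarith), max_eq_left ht.le, measureReal_empty]
    rcases le_or_gt 1 t with ht1 | ht1
    · have : F ⁻¹' Set.Iic t = Set.univ := Set.eq_univ_of_forall fun x => (hF1 x).trans ht1
      rw [this, min_eq_right ht1, probReal_univ]; simp
    rw [min_eq_left ht1.le, max_eq_right ht]
    refine le_antisymm (le_of_forall_gt_imp_ge_of_dense fun t' h => ?_) ?_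
    · rcases lt_or_ge t' 1 with h' | h'
      · exact upper t t' (ht.trans_lt h) h' h
      · exact measureReal_le_one.trans h'
    · rcases ht.eq_or_lt with rfl | ht0
      · exact measureReal_nonneg
      · obtain ⟨x, hx⟩ := surj t ⟨ht0, ht1⟩
        calc t = m.real (Set.Iic x) := hx.symm
          _ ≤ _ := measureReal_mono fun y hy => (mono hy).trans_eq hx
  refine Measure.ext_of_Iic _ _ fun t => ?_
  rw [Measure.map_apply meas measurableSet_Iic, Measure.restrict_apply measurableSet_Iic,
    ← ofReal_measureReal, main]
  have : Set.Iic t ∩ Set.Icc (0 : ℝ) 1 = Set.Icc 0 (min t 1) := by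
    ext x
    simp only [Set.mem_inter_iff, Set.mem_Iic, Set.mem_Icc, le_min_iff]
    tauto
  rw [this, Real.volume_Icc, sub_zero, ENNReal.ofReal_max]
  simp

/-- A uniformly distributed function, injective off a null set, which sorts the points of `Ω`
by their labels. -/
theorem exists_sorting [StandardBorelSpace Ω] (μ : Measure Ω)
    [IsProbabilityMeasure μ] [NullSingletonClass μ] {f : Ω → ℕ} (hf : Measurable f) :
    ∃ T : Ω → ℝ, Measurable T ∧ μ.map T = volume.restrict (Set.Icc (0 : ℝ) 1) ∧
      (∃ N, MeasurableSet N ∧ μ N = 0 ∧ Set.InjOn T Nᶜ) ∧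
      ∀ x, μ.real {y | f y < f x} ≤ T x ∧ T x ≤ μ.real {y | f y ≤ f x} := by
  let s : Ω → ℝ := fun x => Real.sigmoid (embeddingReal Ω x)
  have hs : Measurable s :=
    continuous_sigmoid.measurable.comp (measurableEmbedding_embeddingReal Ω).measurable
  have hsi : Function.Injective s :=
    Real.sigmoid_injective.comp (measurableEmbedding_embeddingReal Ω).injective
  have hs0 : ∀ x, 0 < s x := fun x => Real.sigmoid_pos _
  have hs1 : ∀ x, s x < 1 := fun x => Real.sigmoid_lt_one _
  -- The integer part sorts by label, and the fractional part, in `(0,1)`, injectively breaks ties.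
  -- Since `h` is injective, its law has no atoms.
  let h : Ω → ℝ := fun x => f x + s x
  have hh : Measurable h := (measurable_from_nat.comp hf).add hs
  have lt_of : ∀ x y, f x < f y → h x < h y := by
    intro x y hxy
    have : (f x : ℝ) + 1 ≤ f y := by exact_mod_cast hxy
    have := hs1 x
    have := hs0 y
    simp only [h]; linarith
  have hi : Function.Injective h := by
    intro x y hxy
    rcases lt_trichotomy (f x) (f y) with h1 | h1 | h1
    · exact absurd hxy (lt_of _ _ h1).ne
    · apply hsi
      simp only [h, h1] at hxy
      linarith
    · exact absurd hxy (lt_of _ _ h1).ne'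
  let m := μ.map h
  have : IsProbabilityMeasure m := Measure.isProbabilityMeasure_map hh.aemeasurable
  have : NullSingletonClass m := ⟨fun x => by
    rw [Measure.map_apply hh (measurableSet_singleton x)]
    exact (Set.subsingleton_singleton.preimage hi).measure_zero μ⟩
  obtain ⟨hF, hlaw⟩ := map_distribution_eq_uniform m
  set F : ℝ → ℝ := fun x => m.real (Set.Iic x) with hFdef
  have mono : Monotone F := fun x y hxy => measureReal_mono (Set.Iic_subset_Iic.2 hxy)
  have hT : ∀ x, F (h x) = μ.real {y | h y ≤ h x} := fun x => by
    simp only [hFdef, m]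
    rw [map_measureReal_apply hh measurableSet_Iic]
    rfl
  refine ⟨fun x => F (h x), hF.comp hh, ?_, ?_, fun x => ?_⟩
  · rw [← hlaw, Measure.map_map hF hh]; rfl
  -- A monotone function takes only countably many values more than once, and the uniform law does
  -- not charge them.
  · let D := {c | ∃ x y, x < y ∧ F x = c ∧ F y = c}
    have hD : D.Countable := mono.countable_setOfPred_two_preimages
    refine ⟨h ⁻¹' (F ⁻¹' D), hh (hF hD.measurableSet), ?_, ?_⟩
    · rw [← Measure.map_apply hh (hF hD.measurableSet), ← Measure.map_apply hF hD.measurableSet,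
        hlaw]
      exact hD.measure_zero _
    · intro x hx y hy hxy
      by_contra hne
      have hne' : h x ≠ h y := fun e => hne (hi e)
      rcases lt_or_gt_of_ne hne' with hlt | hlt
      · exact hx ⟨h x, h y, hlt, rfl, hxy.symm⟩
      · exact hx ⟨h y, h x, hlt, hxy.symm, rfl⟩
  · simp only [hT]
    refine ⟨measureReal_mono fun y hy => (lt_of _ _ hy).le, measureReal_mono fun y hy => ?_⟩
    by_contra hlt
    exact absurd hy (not_le.2 (lt_of _ _ (not_le.1 hlt)))

/-- Two labellings with similar distributions agree, outside of a small set, after applying a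
measure preserving bijection. -/
theorem exists_mpBij_label_ne_le [StandardBorelSpace Ω] {μ : Measure Ω}
    [IsProbabilityMeasure μ] [NullSingletonClass μ] {f g : Ω → ℕ} (hf : Measurable f)
    (hg : Measurable g) {M : ℕ} (hfM : ∀ x, f x < M) (hgM : ∀ x, g x < M) :
    ∃ φ : MPBij μ, μ.real {x | f x ≠ g (φ.toEquiv x)} ≤
      ∑ k ∈ Finset.range M, |μ.real {x | f x < k} - μ.real {x | g x < k}| := by
  obtain ⟨T₁, hT₁, l₁, ⟨N₁, mN₁, n₁, i₁⟩, b₁⟩ := exists_sorting μ hf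
  obtain ⟨T₂, hT₂, l₂, ⟨N₂, mN₂, n₂, i₂⟩, b₂⟩ := exists_sorting μ hg
  obtain ⟨φ, hφ⟩ := exists_mpBij_comp_ae_eq hT₁ hT₂ (l₁.trans l₂.symm) mN₁ mN₂ n₁ n₂ i₁ i₂
  refine ⟨φ, ?_⟩
  let a : ℕ → ℝ := fun k => μ.real {x | f x < k}
  let b : ℕ → ℝ := fun k => μ.real {x | g x < k}
  have ma : Monotone a := fun j k hjk => measureReal_mono fun x (hx : f x < j) => hx.trans_le hjk
  have mb : Monotone b := fun j k hjk => measureReal_mono fun x (hx : g x < j) => hx.trans_le hjk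
  have sub : μ {x | f x ≠ g (φ.toEquiv x)} ≤
      μ (⋃ k ∈ Finset.range M, T₁ ⁻¹' Set.uIcc (a k) (b k)) := by
    refine measure_mono_ae ?_
    filter_upwards [hφ] with x hx hne
    have h1 := b₁ x
    have h2 := b₂ (φ.toEquiv x)
    rw [hx] at h2
    simp only [← Order.lt_add_one_iff] at h1 h2
    refine Set.mem_iUnion₂.2 ?_
    -- If the labels differ, take `k` one above the smaller. The sorting bounds then put the common
    -- value `T₁ x = T₂ (φ x)` between `a k` and `b k`, an interval of length `|a k - b k|`.
    rcases lt_or_gt_of_ne (show f x ≠ g (φ.toEquiv x) from hne) with hlt | hlt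
    · refine ⟨f x + 1, Finset.mem_range.2 (lt_of_le_of_lt hlt (hgM _)), ?_⟩
      rw [Set.mem_preimage, Set.uIcc_comm]
      exact Set.Icc_subset_uIcc ⟨(mb hlt).trans h2.1, h1.2⟩
    · refine ⟨g (φ.toEquiv x) + 1, Finset.mem_range.2 (lt_of_le_of_lt hlt (hfM _)), ?_⟩
      exact Set.Icc_subset_uIcc ⟨(ma hlt).trans h1.1, h2.2⟩
  calc μ.real {x | f x ≠ g (φ.toEquiv x)}
      ≤ μ.real (⋃ k ∈ Finset.range M, T₁ ⁻¹' Set.uIcc (a k) (b k)) :=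
        ENNReal.toReal_mono (measure_ne_top _ _) sub
    _ ≤ ∑ k ∈ Finset.range M, μ.real (T₁ ⁻¹' Set.uIcc (a k) (b k)) :=
        measureReal_biUnion_finset_le _ _
    _ ≤ _ := by
        refine Finset.sum_le_sum fun k _ => ?_
        rw [← map_measureReal_apply hT₁ measurableSet_uIcc, l₁]
        refine (ENNReal.toReal_mono ?_ (Measure.restrict_le_self _)).trans ?_
        · simp [Set.uIcc]
        · rw [Real.volume_interval, ENNReal.toReal_ofReal (abs_nonneg _), abs_sub_comm]

end Rearrangement

/-! ### The weak* topology -/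

section WeakStar

variable {Ω : Type*} [MeasurableSpace Ω] {μ : Measure Ω}

theorem Graphon.ae_mem_Icc (W : Graphon μ) : ∀ᵐ p ∂(μ.prod μ), W p ∈ Set.Icc (0 : ℝ) 1 := by
  obtain ⟨w, -, h01, -, hW⟩ := W.2
  filter_upwards [hW] with p hp
  rw [hp]
  exact h01 p

theorem Graphon.ae_abs_le_one (W : Graphon μ) : ∀ᵐ p ∂(μ.prod μ), |W p| ≤ 1 := by
  filter_upwards [W.ae_mem_Icc] with p hp
  rw [abs_le]
  exact ⟨by linarith [hp.1], hp.2⟩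

theorem Graphon.integrable_mul {f : Ω × Ω → ℝ} (hf : Integrable f (μ.prod μ)) (W : Graphon μ) :
    Integrable (fun p => f p * W p) (μ.prod μ) := by
  refine (hf.bdd_mul W.toAEEqFun.aestronglyMeasurable (c := 1) ?_).congr
    (ae_of_all _ fun p => mul_comm _ _)
  simpa only [Real.norm_eq_abs] using W.ae_abs_le_one

theorem continuous_integral_mul {f : Ω × Ω → ℝ} (hf : Integrable f (μ.prod μ)) :
    Continuous fun W : Graphon μ => ∫ p, f p * W p ∂(μ.prod μ) := by
  have h : Continuous fun W : Graphon μ => ∫ p, hf.toL1 f p * W p ∂(μ.prod μ) :=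
    (continuous_apply (A := fun _ => ℝ) (hf.toL1 f)).comp
      (continuous_induced_dom (f := fun (W : Graphon μ) (f : Lp ℝ 1 (μ.prod μ)) =>
        ∫ p, f p * W p ∂(μ.prod μ)))
  refine h.congr fun W => integral_congr_ae ?_
  filter_upwards [hf.coeFn_toL1] with p hp
  rw [hp]

/-- Graphons are bounded by `1`, so as functionals on `L¹` they are equi-Lipschitz; testing on a
dense set of functions therefore suffices. -/
theorem abs_integral_mul_sub_le {f g : Ω × Ω → ℝ} (hf : Integrable f (μ.prod μ))
    (hg : Integrable g (μ.prod μ)) (W : Graphon μ) :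
    |∫ p, f p * W p ∂(μ.prod μ) - ∫ p, g p * W p ∂(μ.prod μ)| ≤
      ∫ p, |f p - g p| ∂(μ.prod μ) := by
  rw [← integral_sub (W.integrable_mul hf) (W.integrable_mul hg)]
  refine abs_integral_le_integral_abs.trans (integral_mono_ae
    ((W.integrable_mul hf).sub (W.integrable_mul hg)).abs (hf.sub hg).abs ?_)
  filter_upwards [W.ae_abs_le_one] with p hp
  rw [← sub_mul, abs_mul]
  exact mul_le_of_le_one_right (abs_nonneg _) hp

theorem setIntegral_eq_integral_indicator_mul {A : Set (Ω × Ω)} (hA : MeasurableSet A)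
    (f : Ω × Ω → ℝ) : ∫ p in A, f p ∂(μ.prod μ) =
      ∫ p, A.indicator (fun _ => (1 : ℝ)) p * f p ∂(μ.prod μ) := by
  rw [← integral_indicator hA]
  congr 1
  ext p
  by_cases h : p ∈ A <;> simp [h]

theorem continuous_setIntegral [IsFiniteMeasure μ] {A : Set (Ω × Ω)} (hA : MeasurableSet A) :
    Continuous fun W : Graphon μ => ∫ p in A, W p ∂(μ.prod μ) := by
  simp only [setIntegral_eq_integral_indicator_mul hA]
  exact continuous_integral_mul ((integrable_const (1 : ℝ)).indicator hA)

/-- Weak* convergence may be tested on measurable sets. -/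
theorem tendsto_of_forall_setIntegral [IsFiniteMeasure μ] {ι : Type*} {l : Filter ι}
    {F : ι → Graphon μ} {W : Graphon μ}
    (h : ∀ A, MeasurableSet A →
      Tendsto (fun i => ∫ p in A, F i p ∂(μ.prod μ)) l (𝓝 (∫ p in A, W p ∂(μ.prod μ)))) :
    Tendsto F l (𝓝 W) := by
  rw [nhds_induced, tendsto_comap_iff, tendsto_pi_nhds]
  suffices H : ∀ f : Ω × Ω → ℝ, Integrable f (μ.prod μ) →
      Tendsto (fun i => ∫ p, f p * F i p ∂(μ.prod μ)) l (𝓝 (∫ p, f p * W p ∂(μ.prod μ))) from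
    fun f => H f (L1.integrable_coeFn f)
  intro f hf
  refine Integrable.induction (P := fun f => Tendsto (fun i => ∫ p, f p * F i p ∂(μ.prod μ)) l
    (𝓝 (∫ p, f p * W p ∂(μ.prod μ)))) ?_ ?_ ?_ ?_ hf
  · intro c s hs _
    have e : ∀ U : Graphon μ, ∫ p, s.indicator (fun _ => c) p * U p ∂(μ.prod μ) =
        c * ∫ p in s, U p ∂(μ.prod μ) := fun U => by
      rw [← integral_const_mul, ← integral_indicator hs]
      congr 1
      ext p
      by_cases hp : p ∈ s <;> simp [hp]
    simp only [e]
    exact (h s hs).const_mul c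
  · intro f g _ hf hg hf' hg'
    have e : ∀ U : Graphon μ, ∫ p, (f + g) p * U p ∂(μ.prod μ) =
        ∫ p, f p * U p ∂(μ.prod μ) + ∫ p, g p * U p ∂(μ.prod μ) := fun U => by
      rw [← integral_add (U.integrable_mul hf) (U.integrable_mul hg)]
      simp [add_mul]
    simp only [e]
    exact hf'.add hg'
  · refine isClosed_of_closure_subset fun f hf => ?_
    refine Metric.tendsto_nhds.2 fun ε hε => ?_
    obtain ⟨g, hg, hfg⟩ := Metric.mem_closure_iff.1 hf (ε / 3) (by linarith)
    have hd : ∫ p, |f p - g p| ∂(μ.prod μ) < ε / 3 := by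
      rw [L1.dist_eq_integral_dist] at hfg
      simpa only [Real.dist_eq] using hfg
    have hfi := L1.integrable_coeFn f
    have hgi := L1.integrable_coeFn g
    have hg : Tendsto (fun i => ∫ p, g p * F i p ∂(μ.prod μ)) l
      (𝓝 (∫ p, g p * W p ∂(μ.prod μ))) := hg
    filter_upwards [Metric.tendsto_nhds.1 hg (ε / 3) (by linarith)] with i hi
    rw [Real.dist_eq] at hi ⊢
    have h1 := abs_lt.1 hi
    have h2 := abs_le.1 (abs_integral_mul_sub_le hfi hgi (F i))
    have h3 := abs_le.1 (abs_integral_mul_sub_le hfi hgi W)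
    rw [abs_lt]
    constructor <;> linarith [h1.1, h1.2, h2.1, h2.2, h3.1, h3.2]
  · intro f g hfg _ hf'
    have e : ∀ U : Graphon μ, ∫ p, f p * U p ∂(μ.prod μ) = ∫ p, g p * U p ∂(μ.prod μ) :=
      fun U => integral_congr_ae (by filter_upwards [hfg] with p hp; rw [hp])
    simpa only [e] using hf'

theorem Graphon.ext_setIntegral [IsFiniteMeasure μ] {U W : Graphon μ}
    (h : ∀ A, MeasurableSet A → ∫ p in A, U p ∂(μ.prod μ) = ∫ p in A, W p ∂(μ.prod μ)) :
    U = W :=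
  Graphon.ext (AEEqFun.ext (U.integrable.ae_eq_of_forall_setIntegral_eq _ _ W.integrable
    fun A hA _ => h A hA))

/-- Weak* convergence may be tested on rectangles. -/
theorem tendsto_of_forall_rectangle [IsFiniteMeasure μ] {ι : Type*} {l : Filter ι}
    {F : ι → Graphon μ} {W : Graphon μ}
    (h : ∀ S T : Set Ω, MeasurableSet S → MeasurableSet T →
      Tendsto (fun i => ∫ p in S ×ˢ T, F i p ∂(μ.prod μ)) l
        (𝓝 (∫ p in S ×ˢ T, W p ∂(μ.prod μ)))) :
    Tendsto F l (𝓝 W) := by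
  refine tendsto_of_forall_setIntegral fun A hA => ?_
  induction A, hA using MeasurableSpace.induction_on_inter generateFrom_prod.symm isPiSystem_prod with
  | empty => simpa using tendsto_const_nhds
  | basic t ht =>
    obtain ⟨S, hS, T, hT, rfl⟩ := ht
    exact h S T hS hT
  | compl t ht ih =>
    have e : ∀ U : Graphon μ, ∫ p in tᶜ, U p ∂(μ.prod μ) =
        ∫ p in Set.univ ×ˢ Set.univ, U p ∂(μ.prod μ) - ∫ p in t, U p ∂(μ.prod μ) := fun U => by
      rw [setIntegral_compl ht U.integrable, Set.univ_prod_univ, setIntegral_univ]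
    simp only [e]
    exact (h _ _ .univ .univ).sub ih
  | iUnion f hd hm ih =>
    have small : Tendsto (fun n => (μ.prod μ).real ((⋃ i, f i) \ ⋃ i ∈ Finset.range n, f i))
        atTop (𝓝 0) := by
      have hanti : Antitone fun n => (⋃ i, f i) \ ⋃ i ∈ Finset.range n, f i := fun m n hmn =>
        Set.sdiff_subset_sdiff_right (Set.biUnion_subset_biUnion_left fun i hi =>
          Finset.mem_range.2 ((Finset.mem_range.1 hi).trans_le hmn))
      have hempty : ⋂ n, ((⋃ i, f i) \ ⋃ i ∈ Finset.range n, f i) = ∅ := by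
        refine Set.eq_empty_of_forall_notMem fun p hp => ?_
        obtain ⟨i, hi⟩ := Set.mem_iUnion.1 (Set.mem_iInter.1 hp 0).1
        exact (Set.mem_iInter.1 hp (i + 1)).2
          (Set.mem_iUnion₂.2 ⟨i, Finset.mem_range.2 i.lt_succ_self, hi⟩)
      have := tendsto_measure_iInter_atTop (μ := μ.prod μ)
        (s := fun n => (⋃ i, f i) \ ⋃ i ∈ Finset.range n, f i)
        (fun n => ((MeasurableSet.iUnion hm).diff
          (Finset.measurableSet_biUnion _ fun i _ => hm i)).nullMeasurableSet) hanti
        ⟨0, measure_ne_top _ _⟩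
      rw [hempty, measure_empty] at this
      exact (ENNReal.tendsto_toReal ENNReal.zero_ne_top).comp this
    -- The error is bounded by the measure of the tail, whatever the graphon, so one `n` serves the
    -- whole family and its limit.
    have approx : ∀ (U : Graphon μ) n,
        |∫ p in ⋃ i, f i, U p ∂(μ.prod μ) - ∑ i ∈ Finset.range n, ∫ p in f i, U p ∂(μ.prod μ)| ≤
          (μ.prod μ).real ((⋃ i, f i) \ ⋃ i ∈ Finset.range n, f i) := fun U n => by
      have hsub : (⋃ i ∈ Finset.range n, f i) ⊆ ⋃ i, f i :=
        Set.iUnion₂_subset fun i _ => Set.subset_iUnion f i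
      rw [← integral_biUnion_finset _ (fun i _ => hm i) (fun i _ j _ hij => hd hij)
        (fun i _ => U.integrable.integrableOn), ← setIntegral_sdiff
        (Finset.measurableSet_biUnion _ fun i _ => hm i) U.integrable.integrableOn hsub]
      have := norm_setIntegral_le_of_norm_le_const_ae
        (μ := μ.prod μ) (s := (⋃ i, f i) \ ⋃ i ∈ Finset.range n, f i) (f := U) (C := 1)
        (measure_lt_top _ _) (by
          filter_upwards [ae_restrict_of_ae U.ae_abs_le_one] with p hp
          exact hp)
      simpa using this
    refine Metric.tendsto_nhds.2 fun ε hε => ?_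
    obtain ⟨n, hn⟩ := (small.eventually (gt_mem_nhds (show (0 : ℝ) < ε / 3 by linarith))).exists
    have hsum := tendsto_finsetSum (Finset.range n) fun i _ => ih i
    filter_upwards [Metric.tendsto_nhds.1 hsum (ε / 3) (by linarith)] with j hj
    rw [Real.dist_eq] at hj ⊢
    have h1 := abs_lt.1 hj
    have h2 := abs_le.1 (approx (F j) n)
    have h3 := abs_le.1 (approx W n)
    rw [abs_lt]
    constructor <;> linarith [h1.1, h1.2, h2.1, h2.2, h3.1, h3.2]

/-- The graphon given by a symmetrization and truncation of `w`. -/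
theorem exists_graphon_ae_eq [IsFiniteMeasure μ] {w : Ω × Ω → ℝ} (hw : Measurable w)
    (h01 : ∀ᵐ p ∂(μ.prod μ), w p ∈ Set.Icc (0 : ℝ) 1)
    (hs : ∀ᵐ p ∂(μ.prod μ), w p.swap = w p) : ∃ W : Graphon μ, W =ᵐ[μ.prod μ] w := by
  -- A graphon needs a representative that is symmetric and `[0,1]`-valued everywhere, so the
  -- exceptional null set has to be repaired.
  let u : Ω × Ω → ℝ := fun p => max 0 (min 1 ((w p + w p.swap) / 2))
  have hu : Measurable u := measurable_const.max
    (measurable_const.min ((hw.add (hw.comp measurable_swap)).div_const 2))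
  have huw : u =ᵐ[μ.prod μ] w := by
    filter_upwards [h01, hs] with p h1 h2
    have : (w p + w p.swap) / 2 = w p := by rw [h2]; ring
    simp only [u, this]
    rw [min_eq_right h1.2, max_eq_right h1.1]
  refine ⟨⟨AEEqFun.mk u hu.aestronglyMeasurable, u, hu, fun p => ⟨le_max_left _ _,
    max_le zero_le_one (min_le_left _ _)⟩, fun x y => ?_, AEEqFun.coeFn_mk _ _⟩,
    (AEEqFun.coeFn_mk _ _).trans huw⟩
  simp only [u, Prod.swap_prod_mk, add_comm]

theorem Graphon.ae_symm [SFinite μ] (W : Graphon μ) : ∀ᵐ p ∂(μ.prod μ), W p.swap = W p := by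
  obtain ⟨w, -, -, hs, hW⟩ := W.2
  have h := (Measure.measurePreserving_swap (μ := μ) (ν := μ)).quasiMeasurePreserving.ae_eq_comp hW
  filter_upwards [hW, h] with p h1 h2
  have h2 : W p.swap = w p.swap := h2
  rw [h1, h2]
  exact hs _ _

theorem Graphon.memLp_two [IsFiniteMeasure μ] (W : Graphon μ) : MemLp W 2 (μ.prod μ) :=
  MemLp.of_bound W.toAEEqFun.aestronglyMeasurable 1
    (by simpa only [Real.norm_eq_abs] using W.ae_abs_le_one)

/-- The indicator function of a set, in the Hilbert space `L²`. -/
def indicatorL2 (μ : Measure Ω) [IsFiniteMeasure μ] {A : Set (Ω × Ω)} (hA : MeasurableSet A) :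
    Lp ℝ 2 (μ.prod μ) :=
  indicatorConstLp 2 hA (measure_ne_top _ A) 1

/-- The functionals on `L²` that are given by graphons. -/
def graphonFunctionals (μ : Measure Ω) [IsFiniteMeasure μ] :
    Set (WeakDual ℝ (Lp ℝ 2 (μ.prod μ))) :=
  WeakDual.toStrongDual ⁻¹' Metric.closedBall 0 ((μ.prod μ).real Set.univ ^ (2⁻¹ : ℝ)) ∩
    {ℓ | ∀ (A : Set (Ω × Ω)) (hA : MeasurableSet A),
      ℓ (indicatorL2 μ hA) ∈ Set.Icc 0 ((μ.prod μ).real A) ∧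
      ℓ (indicatorL2 μ (measurable_swap hA)) = ℓ (indicatorL2 μ hA)}

/-- Banach–Alaoglu, as the conditions on indicators only involve evaluations and are closed. The
radius of the ball is the `L²` norm of the constant `1`. -/
theorem isCompact_graphonFunctionals (μ : Measure Ω) [IsFiniteMeasure μ] :
    IsCompact (graphonFunctionals μ) := by
  refine (WeakDual.isCompact_closedBall 0 _).inter_right ?_
  simp only [Set.ofPred_forall]
  refine isClosed_iInter fun A => isClosed_iInter fun hA => ?_
  exact (isClosed_Icc.preimage (WeakDual.eval_continuous _)).inter
    (isClosed_eq (WeakDual.eval_continuous _) (WeakDual.eval_continuous _))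

/-- The Riesz representative in `L²` inherits its bounds and its symmetry almost everywhere from the
conditions on indicator functions. -/
theorem exists_graphon_of_mem_graphonFunctionals [IsFiniteMeasure μ]
    {ℓ : WeakDual ℝ (Lp ℝ 2 (μ.prod μ))} (h : ℓ ∈ graphonFunctionals μ) :
    ∃ W : Graphon μ, ∀ (A : Set (Ω × Ω)) (hA : MeasurableSet A),
      ∫ p in A, W p ∂(μ.prod μ) = ℓ (indicatorL2 μ hA) := by
  let w : Lp ℝ 2 (μ.prod μ) := (InnerProductSpace.toDual ℝ _).symm (WeakDual.toStrongDual ℓ)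
  have hw : ∀ (A : Set (Ω × Ω)) (hA : MeasurableSet A),
      ∫ p in A, w p ∂(μ.prod μ) = ℓ (indicatorL2 μ hA) := fun A hA => by
    rw [← L2.inner_indicatorConstLp_one (𝕜 := ℝ) hA (measure_ne_top _ _), real_inner_comm]
    exact InnerProductSpace.toDual_symm_apply
  have hi : Integrable w (μ.prod μ) := (Lp.memLp w).integrable one_le_two
  have h0 : 0 ≤ᵐ[μ.prod μ] w := ae_nonneg_of_forall_setIntegral_nonneg hi fun A hA _ => by
    rw [hw A hA]
    exact (h.2 A hA).1.1
  have h1 : 0 ≤ᵐ[μ.prod μ] fun p => 1 - w p :=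
    ae_nonneg_of_forall_setIntegral_nonneg ((integrable_const 1).sub hi) fun A hA _ => by
      rw [integral_sub (integrable_const 1) hi.integrableOn, hw A hA]
      have := (h.2 A hA).1.2
      simpa using this
  have hsi : Integrable (fun p : Ω × Ω => w p.swap) (μ.prod μ) := hi.swap
  have hs : (fun p : Ω × Ω => w p.swap) =ᵐ[μ.prod μ] w :=
    hsi.ae_eq_of_forall_setIntegral_eq _ _ hi fun A hA _ => by
      have := (Measure.measurePreserving_swap (μ := μ) (ν := μ)).setIntegral_preimage_emb
        MeasurableEquiv.prodComm.measurableEmbedding w (Prod.swap ⁻¹' A)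
      rw [← Set.preimage_comp, Prod.swap_swap_eq, Set.preimage_id] at this
      rw [hw A hA, ← (h.2 A hA).2, ← hw]
      exact this
  obtain ⟨W, hW⟩ := exists_graphon_ae_eq (μ := μ) (Lp.stronglyMeasurable w).measurable
    (by filter_upwards [h0, h1] with p h h'; exact ⟨h, by simpa using h'⟩) hs
  exact ⟨W, fun A hA => by rw [← hw A hA]; exact integral_congr_ae (ae_restrict_of_ae hW)⟩

theorem Graphon.exists_functional [IsFiniteMeasure μ] (W : Graphon μ) :
    ∃ ℓ ∈ graphonFunctionals μ, ∀ (A : Set (Ω × Ω)) (hA : MeasurableSet A),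
      ℓ (indicatorL2 μ hA) = ∫ p in A, W p ∂(μ.prod μ) := by
  let w : Lp ℝ 2 (μ.prod μ) := W.memLp_two.toLp
  have hwW : w =ᵐ[μ.prod μ] W := W.memLp_two.coeFn_toLp
  let ℓ : WeakDual ℝ (Lp ℝ 2 (μ.prod μ)) := StrongDual.toWeakDual (InnerProductSpace.toDual ℝ _ w)
  have hℓ : ∀ (A : Set (Ω × Ω)) (hA : MeasurableSet A),
      ℓ (indicatorL2 μ hA) = ∫ p in A, W p ∂(μ.prod μ) := fun A hA => by
    rw [← integral_congr_ae (ae_restrict_of_ae hwW),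
      ← L2.inner_indicatorConstLp_one (𝕜 := ℝ) hA (measure_ne_top _ _), real_inner_comm]
    rfl
  refine ⟨ℓ, ⟨?_, fun A hA => ⟨?_, ?_⟩⟩, hℓ⟩
  · rw [Set.mem_preimage, mem_closedBall_zero_iff]
    have h1 : ‖InnerProductSpace.toDual ℝ (Lp ℝ 2 (μ.prod μ)) w‖ = ‖w‖ :=
      LinearIsometryEquiv.norm_map _ _
    refine h1.trans_le ?_
    have := Lp.norm_le_of_ae_bound (f := w) (p := 2) zero_le_one (by
      filter_upwards [hwW, W.ae_abs_le_one] with p h h'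
      rwa [h, Real.norm_eq_abs])
    simpa [measureReal_def, measureUnivNNReal, ENNReal.coe_toNNReal_eq_toReal] using this
  · rw [hℓ]
    constructor
    · exact setIntegral_nonneg_of_ae (by filter_upwards [W.ae_mem_Icc] with p hp using hp.1)
    · calc ∫ p in A, W p ∂(μ.prod μ) ≤ ∫ p in A, 1 ∂(μ.prod μ) :=
          setIntegral_mono_ae W.integrable.integrableOn (integrable_const 1)
            (by filter_upwards [W.ae_mem_Icc] with p hp using hp.2)
        _ = _ := by simp
  · rw [hℓ, hℓ]
    have := (Measure.measurePreserving_swap (μ := μ) (ν := μ)).setIntegral_preimage_emb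
      MeasurableEquiv.prodComm.measurableEmbedding W A
    rw [← this]
    exact integral_congr_ae (ae_restrict_of_ae (by
      filter_upwards [W.ae_symm] with p hp using hp.symm))

/-- The graphons are a continuous image of the compact set of functionals; continuity is tested on
integrals over measurable sets. -/
instance compactSpace_graphon [IsFiniteMeasure μ] : CompactSpace (Graphon μ) := by
  choose G hG using fun ℓ : graphonFunctionals μ =>
    exists_graphon_of_mem_graphonFunctionals ℓ.2
  have : CompactSpace (graphonFunctionals μ) :=
    isCompact_iff_compactSpace.1 (isCompact_graphonFunctionals μ)
  have hc : Continuous G := continuous_iff_continuousAt.2 fun ℓ =>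
    tendsto_of_forall_setIntegral fun A hA => by
      simp only [hG _ A hA]
      exact ((WeakDual.eval_continuous (indicatorL2 μ hA)).comp
        continuous_subtype_val).tendsto ℓ
  have hs : Function.Surjective G := fun W => by
    obtain ⟨ℓ, hℓ, h⟩ := W.exists_functional
    exact ⟨⟨ℓ, hℓ⟩, Graphon.ext_setIntegral fun A hA => (hG ⟨ℓ, hℓ⟩ A hA).trans (h A hA)⟩
  exact hs.compactSpace hc

/-- On a compact space countably many continuous functions separating points suffice; a dense
sequence in `L¹` provides them. -/
instance metrizableSpace_graphon [MeasurableSpace.CountablyGenerated Ω] [IsFiniteMeasure μ] :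
    TopologicalSpace.MetrizableSpace (Graphon μ) := by
  have : Fact ((1 : ENNReal) ≠ ⊤) := ⟨ENNReal.one_ne_top⟩
  let d := TopologicalSpace.denseSeq (Lp ℝ 1 (μ.prod μ))
  refine Metric.PiNatEmbed.TopologicalSpace.MetrizableSpace.of_countable_separating
    (fun n (W : Graphon μ) => ∫ p, d n p * W p ∂(μ.prod μ))
    (fun n => continuous_integral_mul (L1.integrable_coeFn _)) fun U W hne => ?_
  by_contra! h
  refine hne (Graphon.ext_setIntegral fun A hA => ?_)
  rw [setIntegral_eq_integral_indicator_mul hA, setIntegral_eq_integral_indicator_mul hA]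
  have hf : Integrable (A.indicator fun _ => (1 : ℝ)) (μ.prod μ) :=
    (integrable_const 1).indicator hA
  refine eq_of_abs_sub_le_all fun ε hε => ?_
  obtain ⟨n, hn⟩ := (TopologicalSpace.denseRange_denseSeq (Lp ℝ 1 (μ.prod μ))).exists_dist_lt
    (hf.toL1 _) (show (0 : ℝ) < ε / 2 by linarith)
  have hd : ∫ p, |A.indicator (fun _ => (1 : ℝ)) p - d n p| ∂(μ.prod μ) < ε / 2 := by
    rw [L1.dist_eq_integral_dist] at hn
    refine lt_of_eq_of_lt (integral_congr_ae ?_) hn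
    filter_upwards [hf.coeFn_toL1] with p hp
    rw [hp, Real.dist_eq]
  have h1 := abs_le.1 (abs_integral_mul_sub_le hf (L1.integrable_coeFn (d n)) U)
  have h2 := abs_le.1 (abs_integral_mul_sub_le hf (L1.integrable_coeFn (d n)) W)
  have h3 := h n
  rw [abs_le]
  constructor <;> linarith [h1.1, h1.2, h2.1, h2.2]

end WeakStar

/-! ### Weak regularity and total boundedness -/

section StepKernel

variable {Ω : Type*}

/-- The combination `∑ i, c i • 1_{S i × T i}` of indicator functions of rectangles. -/
def stepKernel {K : ℕ} (c : Fin K → ℝ) (S T : Fin K → Set Ω) (p : Ω × Ω) : ℝ :=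
  ∑ i, c i * (S i ×ˢ T i).indicator (fun _ => (1 : ℝ)) p

open Classical in
/-- The label of a point records which of the sets `S i` and `T i` contain it. -/
def label {K : ℕ} (S T : Fin K → Set Ω) (x : Ω) : ℕ :=
  Fintype.equivFin (Fin K → Bool × Bool) fun i => (decide (x ∈ S i), decide (x ∈ T i))

theorem label_lt {K : ℕ} (S T : Fin K → Set Ω) (x : Ω) :
    label S T x < Fintype.card (Fin K → Bool × Bool) := Fin.is_lt _

theorem mem_iff_of_label_eq {K : ℕ} {S T S' T' : Fin K → Set Ω} {x y : Ω}
    (h : label S T x = label S' T' y) (i : Fin K) :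
    (x ∈ S i ↔ y ∈ S' i) ∧ (x ∈ T i ↔ y ∈ T' i) := by
  have h1 := congrFun ((Fintype.equivFin _).injective (Fin.ext h)) i
  simpa [Prod.ext_iff, decide_eq_decide] using h1

/-- If both coordinates keep their labels, all rectangle indicators agree and only the coefficients
matter. Otherwise each of the `K` terms contributes at most `1` more. -/
theorem abs_stepKernel_sub_le {K : ℕ} {c c' : Fin K → ℝ} (hc : ∀ i, |c' i| ≤ 1)
    {S T S' T' : Fin K → Set Ω} {φ : Ω → Ω} (p : Ω × Ω) :
    |stepKernel c S T p - stepKernel c' S' T' (φ p.1, φ p.2)| ≤ ∑ i, |c i - c' i| +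
      K * ({x | label S T x ≠ label S' T' (φ x)}.indicator (fun _ => (1 : ℝ)) p.1 +
        {x | label S T x ≠ label S' T' (φ x)}.indicator (fun _ => (1 : ℝ)) p.2) := by
  set B := {x | label S T x ≠ label S' T' (φ x)}
  set b := B.indicator (fun _ => (1 : ℝ)) p.1 + B.indicator (fun _ => (1 : ℝ)) p.2 with hb
  have hb0 : 0 ≤ b := add_nonneg (Set.indicator_nonneg (fun _ _ => zero_le_one) _)
    (Set.indicator_nonneg (fun _ _ => zero_le_one) _)
  have hK : ∑ i : Fin K, |c i - c' i| + K * b = ∑ i : Fin K, (|c i - c' i| + b) := by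
    simp [Finset.sum_add_distrib]
  rw [stepKernel, stepKernel, ← Finset.sum_sub_distrib, hK]
  refine (Finset.abs_sum_le_sum_abs _ _).trans (Finset.sum_le_sum fun i _ => ?_)
  set u := (S i ×ˢ T i).indicator (fun _ => (1 : ℝ)) p with hu
  set v := (S' i ×ˢ T' i).indicator (fun _ => (1 : ℝ)) (φ p.1, φ p.2) with hv
  have hu01 : 0 ≤ u ∧ u ≤ 1 := by
    rw [hu]; by_cases h : p ∈ S i ×ˢ T i <;> simp [h]
  have hv01 : 0 ≤ v ∧ v ≤ 1 := by
    rw [hv]; by_cases h : (φ p.1, φ p.2) ∈ S' i ×ˢ T' i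
    · rw [Set.indicator_of_mem h]; norm_num
    · rw [Set.indicator_of_notMem h]; norm_num
  have huv : |u - v| ≤ b := by
    by_cases h : p.1 ∈ B ∨ p.2 ∈ B
    · have h1 : 1 ≤ b := by
        have n1 : 0 ≤ B.indicator (fun _ => (1 : ℝ)) p.1 :=
          Set.indicator_nonneg (fun _ _ => zero_le_one) _
        have n2 : 0 ≤ B.indicator (fun _ => (1 : ℝ)) p.2 :=
          Set.indicator_nonneg (fun _ _ => zero_le_one) _
        rcases h with h | h
        · rw [hb, Set.indicator_of_mem h]; linarith
        · rw [hb, Set.indicator_of_mem h]; linarith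
      refine le_trans ?_ h1
      rw [abs_le]
      constructor <;> linarith [hu01.1, hu01.2, hv01.1, hv01.2]
    · push Not at h
      have h1 := (mem_iff_of_label_eq (not_not.1 h.1) i).1
      have h2 := (mem_iff_of_label_eq (not_not.1 h.2) i).2
      have : u = v := by
        rw [hu, hv]
        by_cases hp : p ∈ S i ×ˢ T i
        · rw [Set.indicator_of_mem hp, Set.indicator_of_mem (show (φ p.1, φ p.2) ∈ S' i ×ˢ T' i
            from ⟨h1.1 hp.1, h2.1 hp.2⟩)]
        · rw [Set.indicator_of_notMem hp, Set.indicator_of_notMem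
            (fun h' : (φ p.1, φ p.2) ∈ S' i ×ˢ T' i => hp ⟨h1.2 h'.1, h2.2 h'.2⟩)]
      rw [this, sub_self, abs_zero]
      exact hb0
  calc |c i * u - c' i * v| = |(c i - c' i) * u + c' i * (u - v)| := by ring_nf
    _ ≤ |c i - c' i| * |u| + |c' i| * |u - v| := by
      rw [← abs_mul, ← abs_mul]; exact abs_add_le _ _
    _ ≤ |c i - c' i| * 1 + 1 * b := by
      gcongr
      · rw [abs_of_nonneg hu01.1]; exact hu01.2
      · exact hc i
    _ = _ := by ring

end StepKernel

section Regularity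

variable {Ω : Type*} [MeasurableSpace Ω] {μ : Measure Ω}

theorem memLp_stepKernel [IsFiniteMeasure μ] {K : ℕ} (c : Fin K → ℝ) {S T : Fin K → Set Ω}
    (hS : ∀ i, MeasurableSet (S i)) (hT : ∀ i, MeasurableSet (T i)) :
    MemLp (stepKernel c S T) 2 (μ.prod μ) :=
  memLp_finsetSum _ fun i _ =>
    ((memLp_const (1 : ℝ)).indicator ((hS i).prod (hT i))).const_mul (c i)

/-- Subtracting its integral over a set `A` from `Y` on `A` decreases the `L²` norm. -/
theorem integral_sq_sub_indicator_le {α : Type*} [MeasurableSpace α] {ν : Measure α}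
    [IsProbabilityMeasure ν] {Y : α → ℝ} (hY : MemLp Y 2 ν) {A : Set α} (hA : MeasurableSet A) :
    ∫ p, (Y p - (∫ q in A, Y q ∂ν) * A.indicator (fun _ => (1 : ℝ)) p) ^ 2 ∂ν ≤
      ∫ p, Y p ^ 2 ∂ν - (∫ q in A, Y q ∂ν) ^ 2 := by
  set a := ∫ q in A, Y q ∂ν
  have hi : Integrable Y ν := hY.integrable one_le_two
  have e : ∀ p, (Y p - a * A.indicator (fun _ => (1 : ℝ)) p) ^ 2 =
      Y p ^ 2 - 2 * a * A.indicator Y p + a ^ 2 * A.indicator (fun _ => (1 : ℝ)) p := fun p => by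
    by_cases hp : p ∈ A
    · simp [hp]; ring
    · simp [hp]
  have h1 : Integrable (fun p => 2 * a * A.indicator Y p) ν := (hi.indicator hA).const_mul _
  have h2 : Integrable (fun p => a ^ 2 * A.indicator (fun _ => (1 : ℝ)) p) ν :=
    ((integrable_const 1).indicator hA).const_mul _
  have h0 : Integrable (fun p => Y p ^ 2 - 2 * a * A.indicator Y p) ν := hY.integrable_sq.sub h1
  simp only [e]
  rw [integral_add h0 h2, integral_sub hY.integrable_sq h1,
    integral_const_mul, integral_const_mul, integral_indicator hA, integral_indicator hA]
  -- The cross term contributes `-2a²` and the square of the correction `a² ν(A) ≤ a²`, a net loss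
  -- of at least `a²`.
  have h3 : ∫ _ in A, (1 : ℝ) ∂ν ≤ 1 := by simp
  have h4 := mul_le_mul_of_nonneg_left h3 (sq_nonneg a)
  have h5 : ∫ p in A, Y p ∂ν = a := rfl
  rw [h5]
  nlinarith

/-- Weak regularity: a graphon is close in the cut norm to a combination of a bounded number of
indicator functions of rectangles. -/
theorem exists_stepKernel_approx [IsProbabilityMeasure μ] (W : Graphon μ) {ε : ℝ} {K : ℕ}
    (hK : 1 < K * ε ^ 2) :
    ∃ (c : Fin K → ℝ) (S T : Fin K → Set Ω), (∀ i, MeasurableSet (S i)) ∧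
      (∀ i, MeasurableSet (T i)) ∧ (∀ i, |c i| ≤ 1) ∧
      cutNorm μ (fun p => W p - stepKernel c S T p) ≤ |ε| := by
  -- Energy decrement: while the cut norm exceeds `|ε|`, a witnessing rectangle lowers the squared
  -- `L²` norm by at least `ε²`. The separate bound by `1` is kept to control the next coefficient.
  have key : ∀ k : ℕ, ∃ (c : Fin k → ℝ) (S T : Fin k → Set Ω), (∀ i, MeasurableSet (S i)) ∧
      (∀ i, MeasurableSet (T i)) ∧ (∀ i, |c i| ≤ 1) ∧
      ∫ p, (W p - stepKernel c S T p) ^ 2 ∂(μ.prod μ) ≤ 1 ∧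
      (cutNorm μ (fun p => W p - stepKernel c S T p) ≤ |ε| ∨
        ∫ p, (W p - stepKernel c S T p) ^ 2 ∂(μ.prod μ) ≤ 1 - k * ε ^ 2) := by
    intro k
    induction k with
    | zero =>
      have h : ∫ p, (W p) ^ 2 ∂(μ.prod μ) ≤ 1 := by
        calc ∫ p, (W p) ^ 2 ∂(μ.prod μ) ≤ ∫ p, 1 ∂(μ.prod μ) :=
            integral_mono_ae W.memLp_two.integrable_sq (integrable_const 1) (by
              filter_upwards [W.ae_abs_le_one] with p hp
              exact (sq_le_one_iff_abs_le_one _).2 hp)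
          _ = 1 := by simp
      refine ⟨Fin.elim0, Fin.elim0, Fin.elim0, fun i => i.elim0, fun i => i.elim0,
        fun i => i.elim0, ?_, Or.inr ?_⟩ <;> simpa [stepKernel] using h
    | succ k ih =>
      obtain ⟨c, S, T, hS, hT, hc, h1, h⟩ := ih
      have snoc : ∀ (a : ℝ) (A B : Set Ω) (p : Ω × Ω),
          stepKernel (Fin.snoc (α := fun _ => ℝ) c a) (Fin.snoc (α := fun _ => Set Ω) S A)
            (Fin.snoc (α := fun _ => Set Ω) T B) p =
            stepKernel c S T p + a * (A ×ˢ B).indicator (fun _ => (1 : ℝ)) p := by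
        intro a A B p
        simp [stepKernel, Fin.sum_univ_castSucc]
      have memSnoc : ∀ {F : Fin k → Set Ω} {A : Set Ω}, (∀ i, MeasurableSet (F i)) →
          MeasurableSet A → ∀ i, MeasurableSet (Fin.snoc (α := fun _ => Set Ω) F A i) := by
        intro F A hF hA i
        refine Fin.lastCases ?_ (fun i => ?_) i
        · simpa using hA
        · simpa using hF i
      have absSnoc : ∀ {a : ℝ}, |a| ≤ 1 → ∀ i, |Fin.snoc (α := fun _ => ℝ) c a i| ≤ 1 := by
        intro a ha i
        refine Fin.lastCases ?_ (fun i => ?_) i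
        · simpa using ha
        · simpa using hc i
      by_cases hgood : cutNorm μ (fun p => W p - stepKernel c S T p) ≤ |ε|
      -- An approximation that is already good is padded with an empty rectangle, so that the number
      -- of terms is the same for every graphon.
      · refine ⟨Fin.snoc (α := fun _ => ℝ) c 0, Fin.snoc (α := fun _ => Set Ω) S ∅,
          Fin.snoc (α := fun _ => Set Ω) T ∅, memSnoc hS .empty, memSnoc hT .empty,
          absSnoc (by simp), ?_, Or.inl ?_⟩
        · simpa [snoc] using h1
        · simpa [snoc] using hgood
      · have hL := h.resolve_left hgood
        obtain ⟨A, B, hA, hB, hAB⟩ : ∃ A B : Set Ω, MeasurableSet A ∧ MeasurableSet B ∧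
            |ε| < |∫ p in A ×ˢ B, (W p - stepKernel c S T p) ∂(μ.prod μ)| := by
          by_contra! hcon
          exact hgood (cutNorm_le hcon)
        set a := ∫ p in A ×ˢ B, (W p - stepKernel c S T p) ∂(μ.prod μ) with ha
        have hdec := integral_sq_sub_indicator_le
          (W.memLp_two.sub (memLp_stepKernel c hS hT)) (hA.prod hB)
        simp only [Pi.sub_apply] at hdec
        rw [← ha] at hdec
        have h0 : 0 ≤ ∫ p, (W p - stepKernel c S T p -
            a * (A ×ˢ B).indicator (fun _ => (1 : ℝ)) p) ^ 2 ∂(μ.prod μ) :=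
          integral_nonneg fun p => sq_nonneg _
        have hε : ε ^ 2 ≤ a ^ 2 := sq_le_sq.2 hAB.le
        -- The new coefficient satisfies `a² ≤ 1`, as `a²` is at most the energy before the step.
        refine ⟨Fin.snoc (α := fun _ => ℝ) c a, Fin.snoc (α := fun _ => Set Ω) S A,
          Fin.snoc (α := fun _ => Set Ω) T B, memSnoc hS hA, memSnoc hT hB,
          absSnoc ((sq_le_one_iff_abs_le_one _).1 (by linarith)), ?_, Or.inr ?_⟩
        · simp only [snoc, ← sub_sub]
          nlinarith [sq_nonneg a]
        · simp only [snoc, ← sub_sub]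
          push_cast
          linarith
  obtain ⟨c, S, T, hS, hT, hc, -, h⟩ := key K
  refine ⟨c, S, T, hS, hT, hc, h.resolve_right fun h' => ?_⟩
  have : 0 ≤ ∫ p, (W p - stepKernel c S T p) ^ 2 ∂(μ.prod μ) :=
    integral_nonneg fun p => sq_nonneg _
  linarith

theorem measurable_label {K : ℕ} {S T : Fin K → Set Ω} (hS : ∀ i, MeasurableSet (S i))
    (hT : ∀ i, MeasurableSet (T i)) : Measurable (label S T) := by
  classical
  have hd : ∀ {A : Set Ω}, MeasurableSet A → Measurable fun x => decide (x ∈ A) := fun hA =>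
    measurable_to_bool (by convert hA; ext x; simp)
  have : Measurable fun x => fun i : Fin K => (decide (x ∈ S i), decide (x ∈ T i)) :=
    measurable_pi_lambda _ fun i => (hd (hS i)).prodMk (hd (hT i))
  exact (measurable_of_countable fun v =>
    ((Fintype.equivFin (Fin K → Bool × Bool) v : ℕ))).comp this

/-- Graphons whose approximations by rectangles have similar parameters are close in the cut
distance. -/
theorem cutDist_le_of_stepKernel [StandardBorelSpace Ω] [IsProbabilityMeasure μ]
    [NullSingletonClass μ] {U W : Graphon μ} {K : ℕ} {c c' : Fin K → ℝ} (hc : ∀ i, |c' i| ≤ 1)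
    {S T S' T' : Fin K → Set Ω} (hS : ∀ i, MeasurableSet (S i)) (hT : ∀ i, MeasurableSet (T i))
    (hS' : ∀ i, MeasurableSet (S' i)) (hT' : ∀ i, MeasurableSet (T' i)) {ε : ℝ}
    (hU : cutNorm μ (fun p => U p - stepKernel c S T p) ≤ ε)
    (hW : cutNorm μ (fun p => W p - stepKernel c' S' T' p) ≤ ε) :
    cutDist U W ≤ 2 * ε + ∑ i, |c i - c' i| +
      2 * K * ∑ k ∈ Finset.range (Fintype.card (Fin K → Bool × Bool)),
        |μ.real {x | label S T x < k} - μ.real {x | label S' T' x < k}| := by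
  obtain ⟨φ, hφ⟩ := exists_mpBij_label_ne_le (μ := μ) (measurable_label hS hT)
    (measurable_label hS' hT') (label_lt S T) (label_lt S' T')
  refine (ciInf_le (bddBelow_cutDist U W) φ).trans (cutNorm_le fun A B hA hB => ?_)
  let Φ : Ω × Ω → Ω × Ω := fun p => (φ.toEquiv p.1, φ.toEquiv p.2)
  have hΦ : MeasurePreserving Φ (μ.prod μ) (μ.prod μ) := φ.prodMap
  have iU := U.integrable.sub ((memLp_stepKernel (μ := μ) c hS hT).integrable one_le_two)
  have iW := W.integrable.sub ((memLp_stepKernel (μ := μ) c' hS' hT').integrable one_le_two)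
  have iS := (memLp_stepKernel (μ := μ) c hS hT).integrable one_le_two
  have iS' : Integrable (fun p => stepKernel c' S' T' (Φ p)) (μ.prod μ) :=
    hΦ.integrable_comp_of_integrable
      ((memLp_stepKernel (μ := μ) c' hS' hT').integrable one_le_two)
  have iWΦ : Integrable (fun p => W (Φ p) - stepKernel c' S' T' (Φ p)) (μ.prod μ) :=
    hΦ.integrable_comp_of_integrable iW
  set E := {x | label S T x ≠ label S' T' (φ.toEquiv x)} with hE
  have mE : MeasurableSet E := (measurableSet_eq_fun (measurable_label hS hT)
    ((measurable_label hS' hT').comp φ.toEquiv.measurable)).compl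
  -- The outer terms are controlled in cut norm, which `φ` preserves; the middle one is controlled
  -- in `L¹` by the set `E` of mismatched labels.
  have e : ∫ p in A ×ˢ B, (U p - version W φ p) ∂(μ.prod μ) =
      ∫ p in A ×ˢ B, (U p - stepKernel c S T p) ∂(μ.prod μ) +
      ∫ p in A ×ˢ B, (stepKernel c S T p - stepKernel c' S' T' (Φ p)) ∂(μ.prod μ) -
      ∫ p in A ×ˢ B, (W (Φ p) - stepKernel c' S' T' (Φ p)) ∂(μ.prod μ) := by
    have h1 : IntegrableOn (fun p => U p - stepKernel c S T p) (A ×ˢ B) (μ.prod μ) :=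
      iU.integrableOn
    have h2 : IntegrableOn (fun p => stepKernel c S T p - stepKernel c' S' T' (Φ p)) (A ×ˢ B)
      (μ.prod μ) := (iS.sub iS').integrableOn
    have h3 : IntegrableOn (fun p => U p - stepKernel c S T p +
      (stepKernel c S T p - stepKernel c' S' T' (Φ p))) (A ×ˢ B) (μ.prod μ) := h1.add h2
    rw [← integral_add h1 h2, ← integral_sub h3 iWΦ.integrableOn]
    refine integral_congr_ae (ae_restrict_of_ae ?_)
    filter_upwards [version_coe W φ] with p hp
    rw [hp]
    simp only [Φ]
    ring
  have b1 := (le_cutNorm iU hA hB).trans hU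
  have b3 : |∫ p in A ×ˢ B, (W (Φ p) - stepKernel c' S' T' (Φ p)) ∂(μ.prod μ)| ≤ ε := by
    have hpre : A ×ˢ B = Φ ⁻¹' ((φ.1.symm ⁻¹' A) ×ˢ (φ.1.symm ⁻¹' B)) := by
      ext p
      simp [Φ]
    rw [hpre, hΦ.setIntegral_preimage_emb (φ.1.prodCongr φ.1).measurableEmbedding
      (fun p => W p - stepKernel c' S' T' p)]
    exact (le_cutNorm iW (φ.1.symm.measurable hA) (φ.1.symm.measurable hB)).trans hW
  have b2 : |∫ p in A ×ˢ B, (stepKernel c S T p - stepKernel c' S' T' (Φ p)) ∂(μ.prod μ)| ≤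
      ∑ i, |c i - c' i| + K * (μ.real E + μ.real E) := by
    have i1 : Integrable (fun p : Ω × Ω => E.indicator (fun _ => (1 : ℝ)) p.1) (μ.prod μ) :=
      (((integrable_const (μ := μ) (1 : ℝ)).indicator mE).comp_fst μ :)
    have i2 : Integrable (fun p : Ω × Ω => E.indicator (fun _ => (1 : ℝ)) p.2) (μ.prod μ) :=
      (((integrable_const (μ := μ) (1 : ℝ)).indicator mE).comp_snd μ :)
    have i3 : Integrable (fun p : Ω × Ω => K * (E.indicator (fun _ => (1 : ℝ)) p.1 +
      E.indicator (fun _ => (1 : ℝ)) p.2)) (μ.prod μ) := (i1.add i2).const_mul _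
    calc |∫ p in A ×ˢ B, (stepKernel c S T p - stepKernel c' S' T' (Φ p)) ∂(μ.prod μ)|
        ≤ ∫ p, |stepKernel c S T p - stepKernel c' S' T' (Φ p)| ∂(μ.prod μ) :=
          abs_integral_le_integral_abs.trans (setIntegral_le_integral (iS.sub iS').abs
            (ae_of_all _ fun p => abs_nonneg _))
      _ ≤ ∫ p, (∑ i, |c i - c' i| + K * (E.indicator (fun _ => (1 : ℝ)) p.1 +
            E.indicator (fun _ => (1 : ℝ)) p.2)) ∂(μ.prod μ) :=
          integral_mono (iS.sub iS').abs ((integrable_const _).add i3)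
            fun p => abs_stepKernel_sub_le hc p
      _ = _ := by
          rw [integral_add (integrable_const _) i3, integral_const_mul,
            integral_add i1 i2, integral_fun_fst (fun x => E.indicator (fun _ => (1 : ℝ)) x),
            integral_fun_snd (fun x => E.indicator (fun _ => (1 : ℝ)) x),
            integral_indicator mE]
          simp
  have b4 := mul_le_mul_of_nonneg_left hφ (Nat.cast_nonneg (α := ℝ) K)
  rw [e]
  have := abs_sub (∫ p in A ×ˢ B, (U p - stepKernel c S T p) ∂(μ.prod μ) +
      ∫ p in A ×ˢ B, (stepKernel c S T p - stepKernel c' S' T' (Φ p)) ∂(μ.prod μ))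
      (∫ p in A ×ˢ B, (W (Φ p) - stepKernel c' S' T' (Φ p)) ∂(μ.prod μ))
  have := abs_add_le (∫ p in A ×ˢ B, (U p - stepKernel c S T p) ∂(μ.prod μ))
      (∫ p in A ×ˢ B, (stepKernel c S T p - stepKernel c' S' T' (Φ p)) ∂(μ.prod μ))
  simp only [Pi.sub_apply] at b1
  linarith

theorem abs_sub_le_of_floor_eq {a b : ℝ} {N : ℕ} (hN : 0 < N) (ha : 0 ≤ a) (hb : 0 ≤ b)
    (h : ⌊N * a⌋₊ = ⌊N * b⌋₊) : |a - b| ≤ 1 / N := by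
  have hN' : (0 : ℝ) < N := Nat.cast_pos.2 hN
  have h1 := Nat.floor_le (mul_nonneg hN'.le ha)
  have h2 := Nat.lt_floor_add_one (N * a)
  have h3 := Nat.floor_le (mul_nonneg hN'.le hb)
  have h4 := Nat.lt_floor_add_one (N * b)
  rw [h] at h1 h2
  rw [abs_le, neg_le, le_div_iff₀ hN', le_div_iff₀ hN']
  constructor <;> nlinarith

theorem totallyBounded_unlabelledGraphon [StandardBorelSpace Ω] [IsProbabilityMeasure μ]
    [NullSingletonClass μ] : TotallyBounded (Set.univ : Set (UnlabelledGraphon μ)) := by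
  refine Metric.totallyBounded_of_finite_discretization fun ε hε => ?_
  have hδ : 0 < ε / 4 := by linarith
  obtain ⟨K, hK⟩ := exists_nat_gt (1 / (ε / 4) ^ 2)
  have hK : 1 < K * (ε / 4) ^ 2 := by rwa [div_lt_iff₀ (by positivity)] at hK
  set M := Fintype.card (Fin K → Bool × Bool)
  choose c S T hS hT hc hcut using fun W : Graphon μ => exists_stepKernel_approx W hK
  rw [abs_of_pos hδ] at hcut
  -- With parameters rounded to the grid of mesh `1/N`, the coefficients and label distributions
  -- cost less than `ε/4`; the two cut norm errors cost `ε/2`.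
  obtain ⟨N, hN⟩ := exists_nat_gt ((K + 2 * K * M) / (ε / 4) : ℝ)
  have hN0 : (0 : ℝ) < N := lt_of_le_of_lt (by positivity) hN
  rw [div_lt_iff₀ hδ] at hN
  let r : Set.univ (α := UnlabelledGraphon μ) → Graphon μ := fun u => Quotient.out u.1
  -- The shift by `1` makes the coefficients nonnegative, so that natural number floors lose
  -- nothing.
  have hc2 : ∀ W i, ⌊N * (c W i + 1)⌋₊ < 2 * N + 1 := fun W i => by
    refine Nat.lt_succ_of_le (Nat.floor_le_of_le ?_)
    push_cast
    nlinarith [(abs_le.1 (hc W i)).2]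
  have hm : ∀ (W : Graphon μ) (k : Fin M),
      ⌊N * μ.real {x | label (S W) (T W) x < k}⌋₊ < N + 1 := fun W k => by
    refine Nat.lt_succ_of_le (Nat.floor_le_of_le ?_)
    exact mul_le_of_le_one_right hN0.le measureReal_le_one
  refine ⟨ULift ((Fin K → Fin (2 * N + 1)) × (Fin M → Fin (N + 1))), inferInstance,
    fun u => ⟨fun i => ⟨_, hc2 (r u) i⟩, fun k => ⟨_, hm (r u) k⟩⟩, fun u w huw => ?_⟩
  have huw := congrArg ULift.down huw
  simp only [Prod.mk.injEq, funext_iff, Fin.mk.injEq] at huw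
  have hd : dist (u : UnlabelledGraphon μ) w = cutDist (r u) (r w) := by
    conv_lhs => rw [← Quotient.out_eq u.1, ← Quotient.out_eq w.1]
    rfl
  rw [hd]
  have h := cutDist_le_of_stepKernel (hc (r w)) (hS (r u)) (hT (r u)) (hS (r w)) (hT (r w))
    (hcut (r u)) (hcut (r w))
  have s1 : ∑ i, |c (r u) i - c (r w) i| ≤ K * (1 / N) := by
    refine (Finset.sum_le_card_nsmul _ _ (1 / N : ℝ) fun i _ => ?_).trans_eq (by simp)
    have := abs_sub_le_of_floor_eq (Nat.cast_pos.1 hN0)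
      (by linarith [(abs_le.1 (hc (r u) i)).1]) (by linarith [(abs_le.1 (hc (r w) i)).1])
      (huw.1 i)
    rwa [add_sub_add_right_eq_sub] at this
  have s2 : ∑ k ∈ Finset.range M, |μ.real {x | label (S (r u)) (T (r u)) x < k} -
      μ.real {x | label (S (r w)) (T (r w)) x < k}| ≤ M * (1 / N) := by
    refine (Finset.sum_le_card_nsmul _ _ (1 / N : ℝ) fun k hk => ?_).trans_eq (by simp)
    exact abs_sub_le_of_floor_eq (Nat.cast_pos.1 hN0) measureReal_nonneg measureReal_nonneg
      (huw.2 ⟨k, Finset.mem_range.1 hk⟩)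
  have s3 := mul_le_mul_of_nonneg_left s2 (show (0 : ℝ) ≤ 2 * K by positivity)
  have s4 : (K : ℝ) * (1 / N) + 2 * K * (M * (1 / N)) < ε / 4 := by
    rw [show (K : ℝ) * (1 / N) + 2 * K * (M * (1 / N)) = (K + 2 * K * M) / N by ring,
      div_lt_iff₀ hN0]
    linarith
  linarith

end Regularity

/-! ### Envelopes -/

/-! ### Hausdorff distances and hyperspaces. -/

section Hausdorff

/-- Compactness bounds the distances, so the Hausdorff distance is finite and the real suprema are
not the default value `0` of an unbounded family. -/
theorem hausdorffDist_range {X ι κ : Type*} [PseudoMetricSpace X] [CompactSpace X] [Nonempty ι]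
    [Nonempty κ] (s : ι → X) (t : κ → X) :
    Metric.hausdorffDist (Set.range s) (Set.range t) =
      max (⨆ i, ⨅ j, dist (s i) (t j)) (⨆ j, ⨅ i, dist (s i) (t j)) := by
  have h1 : ∀ x, ⨅ j, dist x (t j) = Metric.infDist x (Set.range t) := fun x => by
    rw [Metric.infDist_eq_iInf, iInf_range']
  have h2 : ∀ x, ⨅ i, dist (s i) x = Metric.infDist x (Set.range s) := fun x => by
    simp only [Metric.infDist_eq_iInf, dist_comm _ x, iInf_range' (fun y => dist x y)]
  simp only [h1, h2]
  have fin : Metric.hausdorffEDist (Set.range s) (Set.range t) ≠ ⊤ :=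
    Metric.hausdorffEDist_ne_top_of_nonempty_of_bounded (Set.range_nonempty s)
      (Set.range_nonempty t) Metric.isBounded_of_compactSpace Metric.isBounded_of_compactSpace
  have le1 : ∀ i, Metric.infDist (s i) (Set.range t) ≤
      Metric.hausdorffDist (Set.range s) (Set.range t) := fun i =>
    Metric.infDist_le_hausdorffDist_of_mem (Set.mem_range_self i) fin
  have le2 : ∀ j, Metric.infDist (t j) (Set.range s) ≤
      Metric.hausdorffDist (Set.range s) (Set.range t) := fun j => by
    rw [Metric.hausdorffDist_comm]
    exact Metric.infDist_le_hausdorffDist_of_mem (Set.mem_range_self j)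
      (by rwa [Metric.hausdorffEDist_comm])
  refine le_antisymm (Metric.hausdorffDist_le_of_infDist ?_ ?_ ?_) (max_le (ciSup_le le1)
    (ciSup_le le2))
  · exact le_max_of_le_left (Real.iSup_nonneg fun i => Metric.infDist_nonneg)
  · rintro _ ⟨i, rfl⟩
    exact le_max_of_le_left (le_ciSup (f := fun i => Metric.infDist (s i) (Set.range t))
      ⟨_, Set.forall_mem_range.2 le1⟩ i)
  · rintro _ ⟨j, rfl⟩
    exact le_max_of_le_right (le_ciSup (f := fun j => Metric.infDist (t j) (Set.range s))
      ⟨_, Set.forall_mem_range.2 le2⟩ j)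

theorem hausdorffDist_closure_range {X ι κ : Type*} [τ : TopologicalSpace X] [CompactSpace X]
    [Nonempty ι] [Nonempty κ] (ρ : MetricSpace X)
    (h : ρ.toUniformSpace.toTopologicalSpace = τ) (s : ι → X) (t : κ → X) :
    @Metric.hausdorffDist X ρ.toPseudoMetricSpace (closure (Set.range s))
      (closure (Set.range t)) =
      max (⨆ i, ⨅ j, ρ.dist (s i) (t j)) (⨆ j, ⨅ i, ρ.dist (s i) (t j)) := by
  subst h
  rw [Metric.hausdorffDist_closure]
  exact hausdorffDist_range s t

/-- The Hausdorff metric pulled back along a continuous injection of a compact space into the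
hyperspace of nonempty compact sets induces the given topology. -/
theorem exists_metricSpace_dist_eq_hausdorffDist {X Y : Type*} [τ : TopologicalSpace X]
    [υ : TopologicalSpace Y] [CompactSpace Y] (ρ : MetricSpace X)
    (h : ρ.toUniformSpace.toTopologicalSpace = τ) {f : Y → TopologicalSpace.Compacts X}
    (hf : Continuous f) (hi : Function.Injective f) (hne : ∀ y, (f y : Set X).Nonempty) :
    ∃ χ : MetricSpace Y, (∀ u w, χ.dist u w =
        @Metric.hausdorffDist X ρ.toPseudoMetricSpace (f u) (f w)) ∧
      χ.toUniformSpace.toTopologicalSpace = υ := by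
  subst h
  let g : Y → TopologicalSpace.NonemptyCompacts X := fun y => ⟨f y, hne y⟩
  have hg : Continuous g :=
    TopologicalSpace.NonemptyCompacts.isometry_toCompacts.isEmbedding.continuous_iff.2 hf
  have hgi : Function.Injective g := fun u w h =>
    hi (congrArg TopologicalSpace.NonemptyCompacts.toCompacts h)
  -- A continuous injection from a compact space to a Hausdorff space is a closed embedding, so the
  -- induced topology is the given one.
  refine ⟨MetricSpace.induced g hgi inferInstance, fun u w => ?_,
    (hg.isClosedEmbedding hgi).eq_induced.symm⟩
  exact Metric.NonemptyCompacts.dist_eq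

end Hausdorff

/-! ### Envelopes against the cut distance: invariance, injectivity, continuity. -/

section Envelope

variable {Ω : Type*} [MeasurableSpace Ω] {μ : Measure Ω}

theorem abs_setIntegral_sub_le_cutNormDist [IsFiniteMeasure μ] (U W : Graphon μ) {S T : Set Ω}
    (hS : MeasurableSet S) (hT : MeasurableSet T) :
    |∫ p in S ×ˢ T, U p ∂(μ.prod μ) - ∫ p in S ×ˢ T, W p ∂(μ.prod μ)| ≤ cutNormDist U W := by
  rw [← integral_sub U.integrable.integrableOn W.integrable.integrableOn]
  exact le_cutNorm (U.integrable.sub W.integrable) hS hT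

theorem cutNormDist_le [IsFiniteMeasure μ] {U W : Graphon μ} {c : ℝ}
    (h : ∀ S T : Set Ω, MeasurableSet S → MeasurableSet T →
      |∫ p in S ×ˢ T, U p ∂(μ.prod μ) - ∫ p in S ×ˢ T, W p ∂(μ.prod μ)| ≤ c) :
    cutNormDist U W ≤ c :=
  cutNorm_le fun S T hS hT => by
    rw [integral_sub U.integrable.integrableOn W.integrable.integrableOn]
    exact h S T hS hT

theorem tendsto_of_tendsto_cutNormDist [IsFiniteMeasure μ] {ι : Type*} {l : Filter ι}
    {F G : ι → Graphon μ} {W : Graphon μ}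
    (hFG : Tendsto (fun i => cutNormDist (F i) (G i)) l (𝓝 0)) (hF : Tendsto F l (𝓝 W)) :
    Tendsto G l (𝓝 W) := by
  refine tendsto_of_forall_rectangle fun S T hS hT => ?_
  have h1 := ((continuous_setIntegral (μ := μ) (hS.prod hT)).tendsto W).comp hF
  have h2 : Tendsto (fun i => ∫ p in S ×ˢ T, F i p ∂(μ.prod μ) -
      ∫ p in S ×ˢ T, G i p ∂(μ.prod μ)) l (𝓝 0) :=
    squeeze_zero_norm (fun i => abs_setIntegral_sub_le_cutNormDist (F i) (G i) hS hT) hFG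
  simpa using h1.sub h2

/-- The cut norm distance is lower semicontinuous for the weak* topology. -/
theorem cutNormDist_le_of_tendsto [IsFiniteMeasure μ] {ι : Type*} {l : Filter ι} [l.NeBot]
    {F : ι → Graphon μ} {U W : Graphon μ} {c : ℝ} (hF : Tendsto F l (𝓝 W))
    (h : ∀ᶠ i in l, cutNormDist U (F i) ≤ c) : cutNormDist U W ≤ c := by
  refine cutNormDist_le fun S T hS hT => ?_
  have h1 := ((continuous_setIntegral (μ := μ) (hS.prod hT)).tendsto W).comp hF
  refine le_of_tendsto (h1.const_sub (∫ p in S ×ˢ T, U p ∂(μ.prod μ))).abs ?_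
  filter_upwards [h] with i hi
  exact (abs_setIntegral_sub_le_cutNormDist U (F i) hS hT).trans hi

/-- Relabelling both graphons by `φ` does not increase the cut norm, so a good alignment of `U`
itself transfers to each of its versions. -/
theorem exists_cutNormDist_version_lt [IsFiniteMeasure μ] {U W : Graphon μ} {δ : ℝ}
    (h : cutDist U W < δ) (φ : MPBij μ) :
    ∃ ψ : MPBij μ, cutNormDist (version U φ) (version W ψ) < δ := by
  obtain ⟨ψ, hψ⟩ := exists_lt_of_ciInf_lt h
  refine ⟨φ.trans ψ, ?_⟩
  rw [← version_version]
  exact (cutNormDist_version_le _ _ φ).trans_lt hψ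

theorem envelope_subset_of_cutDist_eq_zero [IsFiniteMeasure μ] {U W : Graphon μ}
    (h : cutDist U W = 0) : envelope U ⊆ envelope W := by
  rintro V ⟨φ, hφ⟩
  choose ψ hψ using fun n : ℕ => exists_cutNormDist_version_lt
    (h.trans_lt (Nat.one_div_pos_of_nat (α := ℝ) (n := n))) (φ n)
  exact ⟨ψ, tendsto_of_tendsto_cutNormDist (squeeze_zero (fun n => cutNormDist_nonneg _ _)
    (fun n => (hψ n).le) tendsto_one_div_add_atTop_nhds_zero_nat) hφ⟩

theorem envelope_eq_of_cutDist_eq_zero [IsFiniteMeasure μ] {U W : Graphon μ}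
    (h : cutDist U W = 0) : envelope U = envelope W :=
  (envelope_subset_of_cutDist_eq_zero h).antisymm
    (envelope_subset_of_cutDist_eq_zero ((cutDist_comm W U).trans h))

theorem self_mem_envelope [SFinite μ] (W : Graphon μ) : W ∈ envelope W :=
  ⟨fun _ => MPBij.refl μ, by simpa only [version_refl] using tendsto_const_nhds⟩

/-- The weak* topology is metrizable, so limits of sequences exhaust the closure. -/
theorem envelope_eq_closure [MeasurableSpace.CountablyGenerated Ω] [IsFiniteMeasure μ]
    (W : Graphon μ) : envelope W = closure (Set.range (version W)) := by
  ext U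
  rw [mem_closure_iff_seq_limit]
  constructor
  · rintro ⟨φ, hφ⟩
    exact ⟨_, fun n => ⟨φ n, rfl⟩, hφ⟩
  · rintro ⟨F, hF, hU⟩
    choose φ hφ using hF
    exact ⟨φ, by simpa only [hφ] using hU⟩

theorem integral_sq_version [SFinite μ] (W : Graphon μ) (φ : MPBij μ) :
    ∫ p, version W φ p ^ 2 ∂(μ.prod μ) = ∫ p, W p ^ 2 ∂(μ.prod μ) := by
  rw [← φ.prodMap.integral_comp (φ.1.prodCongr φ.1).measurableEmbedding (fun p => W p ^ 2)]
  refine integral_congr_ae ?_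
  filter_upwards [version_coe W φ] with p hp
  rw [hp]
  rfl

theorem integral_sq_sub [IsFiniteMeasure μ] (U W : Graphon μ) :
    ∫ p, (U p - W p) ^ 2 ∂(μ.prod μ) = ∫ p, U p ^ 2 ∂(μ.prod μ) -
      2 * ∫ p, U p * W p ∂(μ.prod μ) + ∫ p, W p ^ 2 ∂(μ.prod μ) := by
  have hUW := (W.integrable_mul U.integrable).const_mul 2
  have h : Integrable (fun p => U p ^ 2 - 2 * (U p * W p)) (μ.prod μ) :=
    U.memLp_two.integrable_sq.sub hUW
  rw [← integral_const_mul, ← integral_sub U.memLp_two.integrable_sq hUW,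
    ← integral_add h W.memLp_two.integrable_sq]
  congr 1
  ext p
  ring

/-- Weak lower semicontinuity of the `L²` norm: test the convergence against `U` itself and use
`2⟨U, V⟩ ≤ ‖U‖² + ‖V‖²`. -/
theorem integral_sq_le_of_mem_envelope [IsFiniteMeasure μ] {U W : Graphon μ}
    (h : U ∈ envelope W) : ∫ p, U p ^ 2 ∂(μ.prod μ) ≤ ∫ p, W p ^ 2 ∂(μ.prod μ) := by
  obtain ⟨φ, hφ⟩ := h
  have h1 := ((continuous_integral_mul U.integrable).tendsto U).comp hφ
  have h2 : 2 * ∫ p, U p * U p ∂(μ.prod μ) ≤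
      ∫ p, U p ^ 2 ∂(μ.prod μ) + ∫ p, W p ^ 2 ∂(μ.prod μ) := by
    refine le_of_tendsto' (h1.const_mul 2) fun n => ?_
    have h3 := integral_sq_sub U (version W (φ n))
    have h4 : 0 ≤ ∫ p, (U p - version W (φ n) p) ^ 2 ∂(μ.prod μ) :=
      integral_nonneg fun p => sq_nonneg _
    rw [integral_sq_version] at h3
    simp only [Function.comp_apply]
    linarith
  simp only [← pow_two] at h2
  linarith

/-- Integrate `|x| ≤ x²/η + η`. With `η` free, `L²` convergence gives cut norm convergence. -/
theorem cutNormDist_le_integral_sq [IsProbabilityMeasure μ] (U W : Graphon μ) {η : ℝ}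
    (hη : 0 < η) : cutNormDist U W ≤ η⁻¹ * ∫ p, (U p - W p) ^ 2 ∂(μ.prod μ) + η := by
  have hsq : Integrable (fun p => (U p - W p) ^ 2) (μ.prod μ) :=
    (U.memLp_two.sub W.memLp_two).integrable_sq
  refine cutNorm_le fun S T hS hT => ?_
  calc |∫ p in S ×ˢ T, (U p - W p) ∂(μ.prod μ)| ≤ ∫ p, |U p - W p| ∂(μ.prod μ) :=
        abs_integral_le_integral_abs.trans (setIntegral_le_integral
          (U.integrable.sub W.integrable).abs (ae_of_all _ fun p => abs_nonneg _))
    _ ≤ ∫ p, (η⁻¹ * (U p - W p) ^ 2 + η) ∂(μ.prod μ) := by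
        refine integral_mono (U.integrable.sub W.integrable).abs
          ((hsq.const_mul _).add (integrable_const _)) fun p => ?_
        have : η⁻¹ * (U p - W p) ^ 2 + η - |U p - W p| =
            η⁻¹ * ((|U p - W p| - η) ^ 2 + η * |U p - W p|) := by
          rw [← sq_abs]
          field_simp
          ring
        have : 0 ≤ η⁻¹ * ((|U p - W p| - η) ^ 2 + η * |U p - W p|) := by positivity
        linarith
    _ = _ := by
        rw [integral_add (hsq.const_mul _) (integrable_const _), integral_const_mul]
        simp

theorem cutDist_eq_zero_of_envelope_eq [IsProbabilityMeasure μ] {U W : Graphon μ}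
    (h : envelope U = envelope W) : cutDist U W = 0 := by
  have hUW : U ∈ envelope W := h ▸ self_mem_envelope U
  have hWU : W ∈ envelope U := h ▸ self_mem_envelope W
  have hs := (integral_sq_le_of_mem_envelope hUW).antisymm (integral_sq_le_of_mem_envelope hWU)
  obtain ⟨φ, hφ⟩ := hUW
  have h1 := ((continuous_integral_mul U.integrable).tendsto U).comp hφ
  -- Weak convergence with equal norms is strong: the expanded square tends to `‖U‖² - 2‖U‖² +
  -- ‖U‖²`.
  have h2 : Tendsto (fun n => ∫ p, (U p - version W (φ n) p) ^ 2 ∂(μ.prod μ)) atTop (𝓝 0) := by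
    simp only [integral_sq_sub, integral_sq_version, ← hs]
    have h3 := ((h1.const_mul 2).const_sub (∫ p, U p ^ 2 ∂(μ.prod μ))).add_const
      (∫ p, U p ^ 2 ∂(μ.prod μ))
    simp only [Function.comp_apply, ← pow_two] at h3
    convert h3 using 2
    ring
  refine le_antisymm (le_of_forall_gt_imp_ge_of_dense fun η hη => ?_) (cutDist_nonneg _ _)
  have h3 := (h2.const_mul η⁻¹).add_const η
  rw [mul_zero, zero_add] at h3
  exact ge_of_tendsto' h3 fun n => (ciInf_le (bddBelow_cutDist U W) (φ n)).trans
    (cutNormDist_le_integral_sq _ _ hη)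

/-- Metrics compatible with the weak* topology are uniformly controlled by the cut norm. -/
theorem exists_forall_cutNormDist_lt_imp_dist_lt [MeasurableSpace.CountablyGenerated Ω]
    [IsFiniteMeasure μ] (ρ : MetricSpace (Graphon μ))
    (h : ρ.toUniformSpace.toTopologicalSpace = weakStarTopology μ) {ε : ℝ} (hε : 0 < ε) :
    ∃ δ > 0, ∀ U W : Graphon μ, cutNormDist U W < δ → ρ.dist U W < ε := by
  have hc : Continuous fun p : Graphon μ × Graphon μ => ρ.dist p.1 p.2 := by
    rw [← h]
    exact continuous_dist
  by_contra! hcon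
  choose U W hUW hd using fun n : ℕ => hcon _ (Nat.one_div_pos_of_nat (α := ℝ) (n := n))
  -- Along a subsequence both members of the bad pairs converge to the same `V`, so their distance
  -- cannot stay above `ε`.
  obtain ⟨V, k, hk, hV⟩ := CompactSpace.tendsto_subseq U
  have h0 : Tendsto (fun n => cutNormDist (U (k n)) (W (k n))) atTop (𝓝 0) :=
    (squeeze_zero (fun n => cutNormDist_nonneg _ _) (fun n => (hUW n).le)
      tendsto_one_div_add_atTop_nhds_zero_nat).comp hk.tendsto_atTop
  have hW : Tendsto (fun n => W (k n)) atTop (𝓝 V) := tendsto_of_tendsto_cutNormDist h0 hV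
  have hlim := (hc.tendsto (V, V)).comp (hV.prodMk_nhds hW)
  have hle : ε ≤ ρ.dist V V := ge_of_tendsto' hlim fun n => hd (k n)
  rw [ρ.dist_self] at hle
  linarith

theorem isCompact_envelope [MeasurableSpace.CountablyGenerated Ω] [IsFiniteMeasure μ]
    (W : Graphon μ) : IsCompact (envelope W) := by
  rw [envelope_eq_closure]
  exact isClosed_closure.isCompact

/-- The envelope map on weak isomorphism classes. -/
def envelopeMap [MeasurableSpace.CountablyGenerated Ω] [IsFiniteMeasure μ] :
    UnlabelledGraphon μ → TopologicalSpace.Compacts (Graphon μ) :=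
  Quotient.lift (fun W => ⟨envelope W, isCompact_envelope W⟩) fun _ _ h =>
    TopologicalSpace.Compacts.ext (envelope_eq_of_cutDist_eq_zero h)

theorem coe_envelopeMap_mk [MeasurableSpace.CountablyGenerated Ω] [IsFiniteMeasure μ]
    (W : Graphon μ) :
    (envelopeMap (UnlabelledGraphon.mk W) : Set (Graphon μ)) = envelope W := rfl

theorem nonempty_envelopeMap [MeasurableSpace.CountablyGenerated Ω] [IsFiniteMeasure μ]
    (u : UnlabelledGraphon μ) : (envelopeMap u : Set (Graphon μ)).Nonempty := by
  obtain ⟨W⟩ := u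
  exact ⟨W, self_mem_envelope W⟩

theorem injective_envelopeMap [MeasurableSpace.CountablyGenerated Ω] [IsProbabilityMeasure μ] :
    Function.Injective (envelopeMap (μ := μ)) := by
  rintro ⟨U⟩ ⟨W⟩ h
  exact Quotient.sound (cutDist_eq_zero_of_envelope_eq (congrArg SetLike.coe h))

/-- Versions of two cut-close graphons can be matched with uniformly small weak* distance in both
directions; this bounds the Hausdorff distance of their closures. -/
theorem continuous_envelopeMap [MeasurableSpace.CountablyGenerated Ω] [IsFiniteMeasure μ] :
    Continuous (envelopeMap (μ := μ)) := by
  let := TopologicalSpace.metrizableSpaceMetric (Graphon μ)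
  refine continuous_iff_continuousAt.2 fun u => EMetric.tendsto_nhds.2 fun ε hε => ?_
  obtain ⟨η, hη0, hη⟩ := ENNReal.lt_iff_exists_real_btwn.1 hε
  have hη0' : 0 < η := ENNReal.ofReal_pos.1 hη.1
  obtain ⟨δ, hδ, hUW⟩ := exists_forall_cutNormDist_lt_imp_dist_lt (μ := μ) this rfl hη0'
  filter_upwards [Metric.ball_mem_nhds u hδ] with w hw
  obtain ⟨W⟩ := w
  obtain ⟨U⟩ := u
  have hw : cutDist W U < δ := hw
  refine lt_of_le_of_lt ?_ hη.2
  have key : ∀ {U W : Graphon μ}, cutDist U W < δ → ∀ x ∈ Set.range (version U),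
      ∃ y ∈ Set.range (version W), edist x y ≤ ENNReal.ofReal η := by
    rintro U W h _ ⟨φ, rfl⟩
    obtain ⟨ψ, hψ⟩ := exists_cutNormDist_version_lt h φ
    refine ⟨_, ⟨ψ, rfl⟩, ?_⟩
    rw [edist_dist]
    exact ENNReal.ofReal_le_ofReal (hUW _ _ hψ).le
  change Metric.hausdorffEDist (envelope W) (envelope U) ≤ _
  rw [envelope_eq_closure, envelope_eq_closure, Metric.hausdorffEDist_closure]
  exact Metric.hausdorffEDist_le_of_mem_edist (key hw) (key ((cutDist_comm U W).trans_lt hw))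

end Envelope

/-! ### Completeness and compactness for the cut distance. -/

section Compactness

variable {Ω : Type*} [MeasurableSpace Ω] {μ : Measure Ω}

instance completeSpace_unlabelledGraphon [MeasurableSpace.CountablyGenerated Ω]
    [IsFiniteMeasure μ] : CompleteSpace (UnlabelledGraphon μ) := by
  refine Metric.complete_of_convergent_controlled_sequences (fun n => (1 / 2 : ℝ) ^ n)
    (fun n => by positivity) fun u hu => ?_
  let r : ℕ → Graphon μ := fun n => (u n).out
  have hr : ∀ n, UnlabelledGraphon.mk (r n) = u n := fun n => Quotient.out_eq _
  have hd : ∀ n, cutDist (r n) (r (n + 1)) < (1 / 2) ^ n := fun n => by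
    rw [← dist_mk, hr, hr]
    exact hu n n (n + 1) le_rfl n.le_succ
  choose next hnext using fun n => exists_cutNormDist_version_lt (hd n)
  -- Successive alignment: each representative is relabelled to be near the already relabelled
  -- previous one.
  let φ : ℕ → MPBij μ := fun n => Nat.rec (MPBij.refl μ) (fun n ψ => next n ψ) n
  let V : ℕ → Graphon μ := fun n => version (r n) (φ n)
  have hV : ∀ n, cutNormDist (V n) (V (n + 1)) < (1 / 2) ^ n := fun n => hnext n (φ n)
  -- The bound is the exact geometric sum, which makes the induction close.
  have hVk : ∀ n k, cutNormDist (V n) (V (n + k)) ≤ 2 * (1 / 2) ^ n - 2 * (1 / 2) ^ (n + k) := by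
    intro n k
    induction k with
    | zero => simp [cutNormDist_self]
    | succ k ih =>
      have h1 := cutNormDist_triangle (V n) (V (n + k)) (V (n + (k + 1)))
      have h2 := hV (n + k)
      have h3 : (1 / 2 : ℝ) ^ (n + (k + 1)) = (1 / 2) ^ (n + k) * (1 / 2) := by
        rw [← add_assoc, pow_succ]
      rw [h3]
      rw [add_assoc] at h2
      linarith
  obtain ⟨W, k, hk, hW⟩ := CompactSpace.tendsto_subseq V
  refine ⟨UnlabelledGraphon.mk W, tendsto_iff_dist_tendsto_zero.2 ?_⟩
  have hlim : Tendsto (fun n => 2 * (1 / 2 : ℝ) ^ n) atTop (𝓝 0) := by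
    simpa using (tendsto_pow_atTop_nhds_zero_of_lt_one (by norm_num : (0 : ℝ) ≤ 1 / 2)
      (by norm_num)).const_mul 2
  refine squeeze_zero (fun n => dist_nonneg) (fun n => ?_) hlim
  -- Weak* convergence alone does not give cut norm convergence; lower semicontinuity carries the
  -- Cauchy estimate to the limit.
  have hn : cutNormDist (V n) W ≤ 2 * (1 / 2) ^ n := by
    refine cutNormDist_le_of_tendsto hW ?_
    filter_upwards [hk.tendsto_atTop.eventually_ge_atTop n] with j hj
    obtain ⟨i, hi⟩ := Nat.exists_eq_add_of_le hj
    simp only [Function.comp_apply, hi]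
    have : (0 : ℝ) ≤ 2 * (1 / 2) ^ (n + i) := by positivity
    linarith [hVk n i]
  rw [← hr n, dist_mk]
  have h := cutNormDist_version_le (V n) W (φ n).symm
  rw [version_symm] at h
  exact ((ciInf_le (bddBelow_cutDist _ _) _).trans h).trans hn

instance compactSpace_unlabelledGraphon [StandardBorelSpace Ω] [IsProbabilityMeasure μ]
    [NullSingletonClass μ] : CompactSpace (UnlabelledGraphon μ) :=
  ⟨isCompact_iff_totallyBounded_isComplete.2 ⟨totallyBounded_unlabelledGraphon,
    completeSpace_iff_isComplete_univ.1 inferInstance⟩⟩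

end Compactness

end GraphonSpace

end

theorem corollary6p2 {Ω : Type*} [MeasurableSpace Ω] [StandardBorelSpace Ω]
    (μ : MeasureTheory.Measure Ω) [MeasureTheory.IsProbabilityMeasure μ]
    [MeasureTheory.NullSingletonClass μ] :
    -- graphons with the weak* topology form a compact metrizable space
    CompactSpace (GraphonSpace.Graphon μ) ∧
    TopologicalSpace.MetrizableSpace (GraphonSpace.Graphon μ) ∧
    -- the envelope map on weak isomorphism classes, into the hyperspace with the Vietoris topology
    ∃ env : GraphonSpace.UnlabelledGraphon μ →
        TopologicalSpace.Compacts (GraphonSpace.Graphon μ),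
      (∀ W : GraphonSpace.Graphon μ,
        (env (GraphonSpace.UnlabelledGraphon.mk W) : Set (GraphonSpace.Graphon μ))
          = GraphonSpace.envelope W) ∧
      Continuous env ∧ Function.Injective env ∧
      -- homeomorphism onto a closed subspace
      IsClosed (Set.range env) ∧
      (∃ e : GraphonSpace.UnlabelledGraphon μ ≃ₜ Set.range env, ∀ w, (e w).1 = env w) ∧
      -- for every metric compatible with the weak* topology, the pulled back Hausdorff metric
      -- is given by the displayed formula and is topologically equivalent to the cut distance
      (∀ ρ : MetricSpace (GraphonSpace.Graphon μ),
        ρ.toUniformSpace.toTopologicalSpace = GraphonSpace.weakStarTopology μ →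
        ∃ χ : MetricSpace (GraphonSpace.UnlabelledGraphon μ),
          (∀ u w, χ.dist u w = GraphonSpace.hausdorffDistOf ρ (env u) (env w)) ∧
          (∀ U W : GraphonSpace.Graphon μ,
            χ.dist (GraphonSpace.UnlabelledGraphon.mk U) (GraphonSpace.UnlabelledGraphon.mk W) =
              max
                (⨆ φ : GraphonSpace.MPBij μ, ⨅ ψ : GraphonSpace.MPBij μ,
                  ρ.dist (GraphonSpace.version U φ) (GraphonSpace.version W ψ))
                (⨆ φ : GraphonSpace.MPBij μ, ⨅ ψ : GraphonSpace.MPBij μ,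
                  ρ.dist (GraphonSpace.version U ψ) (GraphonSpace.version W φ))) ∧
          χ.toUniformSpace.toTopologicalSpace =
            (GraphonSpace.cutMetric μ).toUniformSpace.toTopologicalSpace) ∧
      -- compactness in the cut distance
      CompactSpace (GraphonSpace.UnlabelledGraphon μ) := by
  have hemb := (GraphonSpace.continuous_envelopeMap (μ := μ)).isClosedEmbedding
    GraphonSpace.injective_envelopeMap
  refine ⟨inferInstance, inferInstance, GraphonSpace.envelopeMap,
    GraphonSpace.coe_envelopeMap_mk, hemb.continuous, hemb.injective, hemb.isClosed_range,
    ⟨hemb.isEmbedding.toHomeomorph, fun _ => rfl⟩, fun ρ hρ => ?_, inferInstance⟩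
  obtain ⟨χ, hχ, htop⟩ := GraphonSpace.exists_metricSpace_dist_eq_hausdorffDist ρ hρ
    hemb.continuous hemb.injective GraphonSpace.nonempty_envelopeMap
  refine ⟨χ, hχ, fun U W => ?_, htop⟩
  rw [hχ, GraphonSpace.coe_envelopeMap_mk, GraphonSpace.coe_envelopeMap_mk,
    GraphonSpace.envelope_eq_closure, GraphonSpace.envelope_eq_closure]
  exact GraphonSpace.hausdorffDist_closure_range ρ hρ _ _
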